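/- Let $X$ be a complex Banach space with algebra $\mathcal L(X)$ of bounded operators. An operator ideal $(\mathcal I,\|\cdot\|_{\mathcal I})$ in $X$ is a two-sided ideal of $\mathcal L(X)$, complete with respect to a norm $\|\cdot\|_{\mathcal I}$ such that $\|ASB\|_{\mathcal I}\le\|A\|\,\|S\|_{\mathcal I}\,\|B\|$ and $\|S\|\le\|S\|_{\mathcal I}$ for all $A,B\in\mathcal L(X)$ and $S\in\mathcal I$. A closed, densely defined operator $A$ on $X$ is nonpositive if $(0,\infty)\subset\rho(A)$ and $M_A:=\sup_{t>0}\|tR(t,A)\|<\infty$, where $R(t,A)=(tI-A)^{-1}$. $\mathcal{OM}_-$ is the class of functions $\varphi$ that are holomorphic in $\mathbb C\setminus[0,\infty)$, satisfy $\operatorname{Im}w\,\operatorname{Im}\varphi(w)\ge0$ there, and for which $\varphi(-0)=\lim_{s\to0-}\varphi(s)$ exists and is real. Such a function has a representation $\varphi(z)=c+bz+\int_{(0,\infty)}\frac{z}{t-z}\,d\mu(t)$, where $c=\varphi(-0)$, $b=\lim_{s\to-\infty}\varphi(s)/s$, and $\mu$ is a unique positive measure on $(0,\infty)$ with $\int_{(0,\infty)}\frac{d\mu(t)}{1+t}<\infty$.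 We assume that $c=b=0$, that is, $\varphi(-0)=0$ and $\lim_{s\to-\infty}\varphi(s)/s=0$. For nonpositive $A$, the operator $\varphi(A)$ is the closure of $x\mapsto\int_{(0,\infty)}AR(t,A)x\,d\mu(t)$, $x\in D(A)$. We write $\varphi'(-0)=\lim_{s\to0-}\varphi'(s)$. For an operator $T$ on $X$ and $U\in\mathcal L(X)$ let $[T,U]=TU-UT$ with domain $\{x\in D(T):Ux\in D(T)\}$. **Corollary 3.8.** Let $U$ be an automorphism of $X$ (a linear homeomorphism of $X$ onto itself), let $\varphi\in\mathcal{OM}_-$ (with $c=b=0$) have $\varphi'(-0)$ finite, and let $A$ be a nonpositive operator on $X$. Suppose that $UD(A)\subseteq D(A)$ or $D(A)\subseteq UD(A)$, and that $[A,U]\in\mathcal I$, in the sense that $[A,U]$ is the restriction to its (dense) domain of an operator from $\mathcal I$, denoted by $[A,U]$ again. Then $UD(\varphi(A))=D(\varphi(A))$, and $[\varphi(A),U]\in\mathcal I$ in the same sense. Moreover, $$\|[\varphi(A),U]\|_{\mathcal I}\le M_A^2\,\varphi'(-0)\,\|[A,U]\|_{\mathcal I}.$$ -/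

import Mathlib

open Filter Topology MeasureTheory

noncomputable section

namespace HirschCalculus

variable {X : Type*} [NormedAddCommGroup X] [NormedSpace ℂ X]

/-! ### Unbounded operators: resolvents and nonpositive operators -/

/-- `R` is the bounded two-sided inverse `(z I - A)⁻¹` of `z I - A : D(A) → X`. -/
def IsResolventAt (A : X →ₗ.[ℂ] X) (z : ℂ) (R : X →L[ℂ] X) : Prop :=
  (∀ x : X, ∃ h : R x ∈ A.domain, z • R x - A ⟨R x, h⟩ = x) ∧
    ∀ x : A.domain, R (z • (x : X) - A x) = x

/-- The resolvent set `ρ(A)` of an unbounded operator. -/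
def resolventSet (A : X →ₗ.[ℂ] X) : Set ℂ :=
  {z | ∃ R : X →L[ℂ] X, IsResolventAt A z R}

open Classical in
/-- The resolvent `R(z, A) = (z I - A)⁻¹` for `z ∈ ρ(A)` (and `0` off the resolvent set). -/
def resolvent (A : X →ₗ.[ℂ] X) (z : ℂ) : X →L[ℂ] X :=
  if h : z ∈ resolventSet A then h.choose else 0

theorem resolvent_spec {A : X →ₗ.[ℂ] X} {z : ℂ} (h : z ∈ resolventSet A) :
    IsResolventAt A z (resolvent A z) := by
  rw [resolvent, dif_pos h]
  exact h.choose_spec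

theorem resolvent_mem_domain (A : X →ₗ.[ℂ] X) (z : ℂ) (x : X) :
    resolvent A z x ∈ A.domain := by
  by_cases h : z ∈ resolventSet A
  · exact ((resolvent_spec h).1 x).1
  · rw [resolvent, dif_neg h]
    exact A.domain.zero_mem

/-- Closed, densely defined operators `A` with `(0, ∞) ⊆ ρ(A)` and
`sup_{t > 0} ‖t R(t, A)‖ < ∞`. -/
structure IsNonpositive (A : X →ₗ.[ℂ] X) : Prop where
  isClosed : A.IsClosed
  dense_domain : Dense (A.domain : Set X)
  mem_resolventSet : ∀ t : ℝ, 0 < t → (t : ℂ) ∈ resolventSet A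
  bddAbove : BddAbove (Set.range fun t : Set.Ioi (0 : ℝ) =>
    ‖((t : ℝ) : ℂ) • resolvent A ((t : ℝ) : ℂ)‖)

/-- The constant `M_A = sup_{t > 0} ‖t R(t, A)‖`. -/
def nonposBound (A : X →ₗ.[ℂ] X) : ℝ :=
  ⨆ t : Set.Ioi (0 : ℝ), ‖((t : ℝ) : ℂ) • resolvent A ((t : ℝ) : ℂ)‖

/-! ### Negative complete Bernstein functions and their representing measures -/

/-- The class `OM₋`: functions holomorphic on `ℂ \ [0, ∞)` with `Im w * Im φ(w) ≥ 0` there,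
for which the limit `φ(-0)` exists and is real. -/
structure NegCompleteBernstein (φ : ℂ → ℂ) : Prop where
  differentiableOn : DifferentiableOn ℂ φ {z : ℂ | 0 ≤ z.re ∧ z.im = 0}ᶜ
  im_mul_im_nonneg : ∀ w ∈ {z : ℂ | 0 ≤ z.re ∧ z.im = 0}ᶜ, 0 ≤ w.im * (φ w).im
  limit_real : ∃ c : ℝ, Tendsto (fun s : ℝ => φ (s : ℂ)) (𝓝[<] 0) (𝓝 (c : ℂ))

/-- `μ` is a positive measure on `(0, ∞)` with `∫ dμ(t) / (1 + t) < ∞` and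
`φ(z) = ∫ z / (t - z) dμ(t)` on `ℂ \ [0, ∞)`. -/
structure IsRepresentingMeasure (φ : ℂ → ℂ) (μ : Measure ℝ) : Prop where
  supported : μ (Set.Iic 0) = 0
  integrable : Integrable (fun t : ℝ => 1 / (1 + t)) μ
  eq_integral : ∀ z ∈ {z : ℂ | 0 ≤ z.re ∧ z.im = 0}ᶜ,
    φ z = ∫ t in Set.Ioi (0 : ℝ), z / ((t : ℂ) - z) ∂μ

open Classical in
/-- The representing measure of `φ`. A function of class `OM₋` has exactly one as soon as the
constant term `φ(-0)` and the linear coefficient `lim_{s → -∞} φ(s) / s` of its integral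
representation vanish; the value `0` for other functions plays no role. -/
def representingMeasure (φ : ℂ → ℂ) : Measure ℝ :=
  if h : ∃ μ : Measure ℝ, IsRepresentingMeasure φ μ then h.choose else 0

/-! ### The Hirsch functional calculus -/

/-- The linear map `x ↦ A R(t, A) x`. -/
def opResolvent (A : X →ₗ.[ℂ] X) (t : ℝ) : X →ₗ[ℂ] X :=
  A.toFun ∘ₗ ((resolvent A (t : ℂ) : X →L[ℂ] X) : X →ₗ[ℂ] X).codRestrict A.domain
    (resolvent_mem_domain A (t : ℂ))

theorem opResolvent_apply (A : X →ₗ.[ℂ] X) (t : ℝ) (x : X) :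
    opResolvent A t x = A ⟨resolvent A (t : ℂ) x, resolvent_mem_domain A (t : ℂ) x⟩ := rfl

/-- The operator `x ↦ ∫_{(0, ∞)} A R(t, A) x dμ(t)` on the vectors `x ∈ D(A)` for which the
integral converges. For nonpositive `A` and `∫ dμ(t) / (1 + t) < ∞` these are all vectors of
`D(A)`, see `hirschIntegral_domain`. -/
def hirschIntegral (μ : Measure ℝ) (A : X →ₗ.[ℂ] X) : X →ₗ.[ℂ] X where
  domain :=
    { carrier := {x | x ∈ A.domain ∧
        IntegrableOn (fun t : ℝ => opResolvent A t x) (Set.Ioi 0) μ}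
      add_mem' := by
        rintro x y ⟨hx, hx'⟩ ⟨hy, hy'⟩
        refine ⟨A.domain.add_mem hx hy, ?_⟩
        simp only [map_add]
        exact hx'.add hy'
      zero_mem' := by
        refine ⟨A.domain.zero_mem, ?_⟩
        simp only [map_zero]
        exact integrableOn_zero
      smul_mem' := by
        rintro c x ⟨hx, hx'⟩
        refine ⟨A.domain.smul_mem c hx, ?_⟩
        simp only [map_smul]
        exact hx'.smul c }
  toFun :=
    { toFun := fun x => ∫ t in Set.Ioi (0 : ℝ), opResolvent A t (x : X) ∂μ
      map_add' := by
        rintro ⟨x, hx⟩ ⟨y, hy⟩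
        simp only [Submodule.coe_add, map_add]
        exact integral_add hx.2 hy.2
      map_smul' := by
        rintro c ⟨x, hx⟩
        simp only [Submodule.coe_smul, map_smul, RingHom.id_apply]
        exact integral_smul c _ }

theorem norm_resolvent_le {A : X →ₗ.[ℂ] X} (hA : IsNonpositive A) {t : ℝ} (ht : 0 < t) :
    ‖resolvent A (t : ℂ)‖ ≤ nonposBound A / t := by
  have h := le_ciSup hA.bddAbove ⟨t, ht⟩
  rw [le_div_iff₀ ht, mul_comm]
  simpa [nonposBound, norm_smul, abs_of_pos ht] using h

theorem resolvent_sub_resolvent {A : X →ₗ.[ℂ] X} {z w : ℂ} (hz : z ∈ resolventSet A)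
    (hw : w ∈ resolventSet A) (x : X) :
    resolvent A z x - resolvent A w x = (w - z) • resolvent A z (resolvent A w x) := by
  obtain ⟨hd, he⟩ := (resolvent_spec hw).1 x
  have h1 := (resolvent_spec hz).2 ⟨_, hd⟩
  have h2 : z • resolvent A w x - A ⟨_, hd⟩ = x - (w - z) • resolvent A w x := by
    nth_rewrite 3 [← he]
    rw [sub_smul]
    abel
  simp only [h2, map_sub, map_smul] at h1
  exact (sub_eq_iff_eq_add.2 (sub_eq_iff_eq_add'.1 h1))

theorem opResolvent_eq {A : X →ₗ.[ℂ] X} {t : ℝ} (h : (t : ℂ) ∈ resolventSet A) (x : X) :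
    opResolvent A t x = (t : ℂ) • resolvent A (t : ℂ) x - x := by
  obtain ⟨hd, he⟩ := (resolvent_spec h).1 x
  rw [opResolvent_apply]
  exact eq_sub_of_add_eq (sub_eq_iff_eq_add'.1 he).symm

theorem opResolvent_comm {A : X →ₗ.[ℂ] X} {t : ℝ} (h : (t : ℂ) ∈ resolventSet A)
    (x : A.domain) : opResolvent A t x = resolvent A (t : ℂ) (A x) := by
  rw [opResolvent_eq h]
  have := (resolvent_spec h).2 x
  rw [map_sub, map_smul] at this
  nth_rewrite 2 [← this]
  abel

theorem continuousOn_resolvent {A : X →ₗ.[ℂ] X} (hA : IsNonpositive A) (x : X) :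
    ContinuousOn (fun t : ℝ => resolvent A (t : ℂ) x) (Set.Ioi 0) := by
  intro s hs
  have hs' : (0 : ℝ) < s := hs
  rw [ContinuousWithinAt, tendsto_iff_norm_sub_tendsto_zero]
  have hlim : Tendsto (fun t : ℝ => |s - t| * (nonposBound A / t * ‖resolvent A (s : ℂ) x‖))
      (𝓝[Set.Ioi 0] s) (𝓝 0) := by
    have : ContinuousAt
        (fun t : ℝ => |s - t| * (nonposBound A / t * ‖resolvent A (s : ℂ) x‖)) s := by
      fun_prop (disch := exact hs'.ne')
    have h0 := this.tendsto
    simp only [sub_self, abs_zero, zero_mul] at h0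
    exact h0.mono_left nhdsWithin_le_nhds
  refine squeeze_zero' (Eventually.of_forall fun _ => norm_nonneg _) ?_ hlim
  filter_upwards [self_mem_nhdsWithin] with t ht
  rw [resolvent_sub_resolvent (hA.mem_resolventSet t ht) (hA.mem_resolventSet s hs), norm_smul,
    ← Complex.ofReal_sub, Complex.norm_real, Real.norm_eq_abs]
  gcongr
  exact (ContinuousLinearMap.le_opNorm _ _).trans
    (mul_le_mul_of_nonneg_right (norm_resolvent_le hA ht) (norm_nonneg _))

/-- For nonpositive `A` the defining integral of `φ(A) x` converges for every `x ∈ D(A)`. -/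
theorem hirschIntegral_domain {A : X →ₗ.[ℂ] X} (hA : IsNonpositive A) {μ : Measure ℝ}
    (hμ : Integrable (fun t : ℝ => 1 / (1 + t)) μ) :
    (hirschIntegral μ A).domain = A.domain := by
  refine le_antisymm (fun x hx => hx.1) fun x hx => ⟨hx, ?_⟩
  have hM : 0 ≤ nonposBound A :=
    Real.iSup_nonneg fun t => norm_nonneg _
  set C : ℝ := 2 * ((nonposBound A + 1) * ‖x‖) + 2 * (nonposBound A * ‖A ⟨x, hx⟩‖) with hC
  have hg : IntegrableOn (fun t : ℝ => C * (1 / (1 + t))) (Set.Ioi 0) μ :=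
    (hμ.const_mul C).integrableOn
  refine Integrable.mono' hg ?_ ?_
  · have hcont : ContinuousOn (fun t : ℝ => (t : ℂ) • resolvent A (t : ℂ) x - x) (Set.Ioi 0) :=
      ((Complex.continuous_ofReal.continuousOn).smul (continuousOn_resolvent hA x)).sub
        continuousOn_const
    refine (hcont.aestronglyMeasurable measurableSet_Ioi).congr ?_
    filter_upwards [ae_restrict_mem measurableSet_Ioi] with t ht
    exact (opResolvent_eq (hA.mem_resolventSet t ht) x).symm
  · filter_upwards [ae_restrict_mem measurableSet_Ioi] with t ht
    have ht' : (0 : ℝ) < t := ht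
    have hR := norm_resolvent_le hA ht'
    rw [mul_one_div, le_div_iff₀ (by linarith)]
    have h1 : ‖opResolvent A t x‖ ≤ (nonposBound A + 1) * ‖x‖ := by
      rw [opResolvent_eq (hA.mem_resolventSet t ht)]
      refine (norm_sub_le _ _).trans ?_
      rw [norm_smul, Complex.norm_real, Real.norm_eq_abs, abs_of_pos ht', add_mul, one_mul]
      refine add_le_add_left ?_ _
      calc t * ‖resolvent A (t : ℂ) x‖ ≤ t * (nonposBound A / t * ‖x‖) := by
            gcongr
            exact (ContinuousLinearMap.le_opNorm _ _).trans
              (mul_le_mul_of_nonneg_right hR (norm_nonneg _))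
        _ = nonposBound A * ‖x‖ := by field_simp
    have h2 : t * ‖opResolvent A t x‖ ≤ nonposBound A * ‖A ⟨x, hx⟩‖ := by
      have := opResolvent_comm (hA.mem_resolventSet t ht) ⟨x, hx⟩
      simp only at this
      rw [this]
      calc t * ‖resolvent A (t : ℂ) (A ⟨x, hx⟩)‖
          ≤ t * (nonposBound A / t * ‖A ⟨x, hx⟩‖) := by
            gcongr
            exact (ContinuousLinearMap.le_opNorm _ _).trans
              (mul_le_mul_of_nonneg_right hR (norm_nonneg _))
        _ = nonposBound A * ‖A ⟨x, hx⟩‖ := by field_simp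
    have h3 := norm_nonneg (opResolvent A t x)
    have h4 : 0 ≤ (nonposBound A + 1) * ‖x‖ := by positivity
    have h5 : 0 ≤ nonposBound A * ‖A ⟨x, hx⟩‖ := by positivity
    rw [hC]
    nlinarith

/-- The operator `φ(A)`: the closure of `x ↦ ∫_{(0, ∞)} A R(t, A) x dμ(t)`, `x ∈ D(A)`, where
`μ` is the representing measure of `φ`. -/
def hirschOp (φ : ℂ → ℂ) (A : X →ₗ.[ℂ] X) : X →ₗ.[ℂ] X :=
  (hirschIntegral (representingMeasure φ) A).closure

/-! ### Commutators -/

/-- The product `T U` with its natural domain `{x | U x ∈ D(T)}`. -/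
def mulBounded (T : X →ₗ.[ℂ] X) (U : X →L[ℂ] X) : X →ₗ.[ℂ] X where
  domain := T.domain.comap (U : X →ₗ[ℂ] X)
  toFun := T.toFun ∘ₗ
    ((U : X →ₗ[ℂ] X) ∘ₗ (T.domain.comap (U : X →ₗ[ℂ] X)).subtype).codRestrict T.domain
      (fun x => x.2)

/-- The commutator `[T, U] = T U - U T` with its natural domain `{x ∈ D(T) | U x ∈ D(T)}`. -/
def commutator (T : X →ₗ.[ℂ] X) (U : X →L[ℂ] X) : X →ₗ.[ℂ] X :=
  mulBounded T U - (U : X →ₗ[ℂ] X).compPMap T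

/-! ### Operator ideals -/

/-- A two-sided ideal of the algebra of bounded operators on `X` with a complete norm such that
`‖A S B‖_I ≤ ‖A‖ ‖S‖_I ‖B‖` and `‖S‖ ≤ ‖S‖_I`. -/
structure OperatorIdeal (X : Type*) [NormedAddCommGroup X] [NormedSpace ℂ X] where
  carrier : Submodule ℂ (X →L[ℂ] X)
  mul_mem_left : ∀ (A : X →L[ℂ] X), ∀ S ∈ carrier, A * S ∈ carrier
  mul_mem_right : ∀ (B : X →L[ℂ] X), ∀ S ∈ carrier, S * B ∈ carrier
  /-- The norm `‖·‖_I`; it is definite by `norm_le_nrm`. -/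
  nrm : Seminorm ℂ carrier
  complete : ∀ u : ℕ → carrier,
    (∀ ε > 0, ∃ N, ∀ m ≥ N, ∀ n ≥ N, nrm (u m - u n) < ε) →
      ∃ S : carrier, Tendsto (fun n => nrm (u n - S)) atTop (𝓝 0)
  nrm_mul_mul_le : ∀ (A B : X →L[ℂ] X) (S : carrier),
    nrm ⟨A * S * B, mul_mem_right B _ (mul_mem_left A _ S.2)⟩ ≤ ‖A‖ * nrm S * ‖B‖
  norm_le_nrm : ∀ S : carrier, ‖(S : X →L[ℂ] X)‖ ≤ nrm S

end HirschCalculus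

end

open Filter Topology MeasureTheory

noncomputable section

namespace HirschCalculus

variable {X : Type*} [NormedAddCommGroup X] [NormedSpace ℂ X]

/-! Write `K` for the bounded commutator and `R = R(t, A)`. From `A U = U A + K` on `D(A)` one gets
`R U - U R = R K R` (`HasCommutator.resolvent_comm`). Since `A R = t R - 1`, the commutator of `A R`
with `U` is `t R K R`, whose ideal norm is at most `t (M_A / t)² ‖K‖ = M_A² ‖K‖ / t`. Integrating
against `μ` inside the Banach space formed by the ideal gives the commutator on `D(A)`, with bound
`M_A² ‖K‖ ∫ dμ(t) / t`, and `∫ dμ(t) / t = φ'(-0)` (`IsRepresentingMeasure.integral_one_div`). A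
bounded commutator passes to the closure because it says that the graph is invariant under a
continuous map.

Equality of domains comes from the same identity. For large `t` it reads `U R = R W U` with `W`
invertible, so `U D(A) = D(A)`. If only `D(A) ⊆ U D(A)` is known, the argument is run for `U⁻¹`,
whose commutator is `-U⁻¹ K U⁻¹`.

Two facts about `φ(A)` itself need proof. The integral operator must be closable
(`isClosable_hirschIntegral`), and `φ` must have a representing measure. For the latter, `ℂ \ [0,
∞)` is mapped conformally to the disc, where `φ` becomes a typically real function; Rogosinski's
formula, obtained from a Cauchy-type formula on circles and weak compactness, gives a finite measure
on `[0, 1]`, a model of `[0, ∞]`. The conditions `c = b = 0` remove the two endpoint atoms, and a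
change of variable yields `μ`. -/

/-! ### Operator ideals as Banach spaces -/

namespace OperatorIdeal

/-- The operator ideal as a normed space under its own norm. -/
def Space (I : OperatorIdeal X) : Type _ := I.carrier

instance (I : OperatorIdeal X) : AddCommGroup I.Space := inferInstanceAs (AddCommGroup I.carrier)

instance (I : OperatorIdeal X) : Module ℂ I.Space := inferInstanceAs (Module ℂ I.carrier)

/-- The ideal norm as a group norm. -/
def groupNorm (I : OperatorIdeal X) : AddGroupNorm I.Space where
  toFun S := I.nrm S
  map_zero' := map_zero I.nrm
  add_le' := map_add_le_add I.nrm
  neg' := map_neg_eq_map I.nrm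
  eq_zero_of_map_eq_zero' S hS := by
    have h := I.norm_le_nrm S
    rw [hS] at h
    exact Subtype.ext (norm_le_zero_iff.1 h)

/-- As a subspace of the bounded operators, `I.carrier` already carries the operator norm; the type
synonym keeps the two norms apart. -/
instance (I : OperatorIdeal X) : NormedAddCommGroup I.Space :=
  I.groupNorm.toNormedAddCommGroup

theorem norm_space_def (I : OperatorIdeal X) (S : I.Space) : ‖S‖ = I.nrm S := rfl

instance (I : OperatorIdeal X) : NormedSpace ℂ I.Space where
  norm_smul_le c S := (map_smul_eq_mul I.nrm c S).le

/-- Completeness makes Bochner integrals with values in the ideal available, which is how the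
commutator of `φ(A)` is shown to lie in it. -/
instance (I : OperatorIdeal X) : CompleteSpace I.Space := by
  refine Metric.complete_of_cauchySeq_tendsto fun u hu => ?_
  obtain ⟨S, hS⟩ := I.complete u fun ε hε => by
    obtain ⟨N, hN⟩ := Metric.cauchySeq_iff.1 hu ε hε
    refine ⟨N, fun m hm n hn => ?_⟩
    have := hN m hm n hn
    rwa [dist_eq_norm] at this
  exact ⟨S, tendsto_iff_norm_sub_tendsto_zero.2 hS⟩

/-- The inclusion of the ideal into the algebra of bounded operators. -/
def inclusion (I : OperatorIdeal X) : I.Space →L[ℂ] (X →L[ℂ] X) :=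
  LinearMap.mkContinuous (I.carrier.subtype : I.Space →ₗ[ℂ] (X →L[ℂ] X)) 1 fun S => by
    rw [one_mul]
    exact I.norm_le_nrm S

theorem inclusion_injective (I : OperatorIdeal X) : Function.Injective I.inclusion :=
  Subtype.val_injective

/-- The bounded bilinear map `(A, B) ↦ A S B` with values in the ideal. -/
def sandwich (I : OperatorIdeal X) (S : I.Space) :
    (X →L[ℂ] X) →L[ℂ] (X →L[ℂ] X) →L[ℂ] I.Space :=
  LinearMap.mkContinuous₂
    (LinearMap.mk₂ ℂ
      (fun A B => (show I.Space from ⟨A * I.inclusion S * B,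
        I.mul_mem_right B _ (I.mul_mem_left A _ (show I.carrier from S).2)⟩))
      (fun A A' B => I.inclusion_injective (by
        change (A + A') * _ * B = A * _ * B + A' * _ * B
        rw [add_mul, add_mul]))
      (fun c A B => I.inclusion_injective (by
        change (c • A) * _ * B = c • (A * _ * B)
        rw [smul_mul_assoc, smul_mul_assoc]))
      (fun A B B' => I.inclusion_injective (by
        change A * _ * (B + B') = A * _ * B + A * _ * B'
        rw [mul_add]))
      (fun c A B => I.inclusion_injective (by
        change A * _ * (c • B) = c • (A * _ * B)
        rw [mul_smul_comm])))
    ‖S‖ (fun A B => (I.nrm_mul_mul_le A B S).trans_eq (by rw [norm_space_def]; ring))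

theorem inclusion_sandwich (I : OperatorIdeal X) (S : I.Space) (A B : X →L[ℂ] X) :
    I.inclusion (I.sandwich S A B) = A * I.inclusion S * B := rfl

theorem norm_sandwich_le (I : OperatorIdeal X) (S : I.Space) (A B : X →L[ℂ] X) :
    ‖I.sandwich S A B‖ ≤ ‖A‖ * ‖S‖ * ‖B‖ :=
  I.nrm_mul_mul_le A B S

end OperatorIdeal

/-! ### Resolvents and commutators -/

theorem nonposBound_nonneg (A : X →ₗ.[ℂ] X) : 0 ≤ nonposBound A :=
  Real.iSup_nonneg fun _ => norm_nonneg _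

/-- The resolvent identity bounds `‖R(t) - R(s)‖` by `|s - t| (M_A / t) ‖R(s)‖`. Norm continuity,
not just strong continuity, is what makes `t ↦ R(t) K R(t)` measurable for the ideal norm. -/
theorem continuousOn_resolvent_norm {A : X →ₗ.[ℂ] X} (hA : IsNonpositive A) :
    ContinuousOn (fun t : ℝ => resolvent A (t : ℂ)) (Set.Ioi 0) := by
  intro s hs
  have hs' : (0 : ℝ) < s := hs
  rw [ContinuousWithinAt, tendsto_iff_norm_sub_tendsto_zero]
  have hlim : Tendsto (fun t : ℝ => |s - t| * (nonposBound A / t * ‖resolvent A (s : ℂ)‖))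
      (𝓝[Set.Ioi 0] s) (𝓝 0) := by
    have : ContinuousAt
        (fun t : ℝ => |s - t| * (nonposBound A / t * ‖resolvent A (s : ℂ)‖)) s := by
      fun_prop (disch := exact hs'.ne')
    have h0 := this.tendsto
    simp only [sub_self, abs_zero, zero_mul] at h0
    exact h0.mono_left nhdsWithin_le_nhds
  refine squeeze_zero' (Eventually.of_forall fun _ => norm_nonneg _) ?_ hlim
  filter_upwards [self_mem_nhdsWithin] with t ht
  have ht' : (0 : ℝ) < t := ht
  have hRt := norm_resolvent_le hA ht
  have hM := nonposBound_nonneg A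
  refine ContinuousLinearMap.opNorm_le_bound _ (by positivity) fun x => ?_
  rw [_root_.sub_apply,
    resolvent_sub_resolvent (hA.mem_resolventSet t ht) (hA.mem_resolventSet s hs), norm_smul,
    ← Complex.ofReal_sub, Complex.norm_real, Real.norm_eq_abs, mul_assoc, mul_assoc]
  gcongr
  exact (ContinuousLinearMap.le_opNorm _ _).trans
    (mul_le_mul hRt (ContinuousLinearMap.le_opNorm _ _) (norm_nonneg _) (by positivity))

/-- `U` maps `D(A)` into itself and `A U - U A` extends to the bounded operator `K`. -/
def HasCommutator (A : X →ₗ.[ℂ] X) (U K : X →L[ℂ] X) : Prop :=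
  ∀ x : A.domain, ∃ h : U x ∈ A.domain, A ⟨U x, h⟩ = U (A x) + K x

/-- This graph form of the commutator relation is the one that survives closure. -/
theorem HasCommutator.mem_graph {A : X →ₗ.[ℂ] X} {U K : X →L[ℂ] X} (h : HasCommutator A U K)
    {x y : X} (hxy : (x, y) ∈ A.graph) : (U x, U y + K x) ∈ A.graph := by
  obtain ⟨z, rfl, rfl⟩ := (LinearPMap.mem_graph_iff A).1 hxy
  obtain ⟨hd, he⟩ := h z
  exact (LinearPMap.mem_graph_iff A).2 ⟨⟨_, hd⟩, rfl, he⟩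

/-- Apply `R(z)` to `(z - A) U R(z) y = U y - K R(z) y`. The relation now involves bounded operators
only, with `K` between two resolvents. -/
theorem HasCommutator.resolvent_comm {A : X →ₗ.[ℂ] X} {U K : X →L[ℂ] X} (h : HasCommutator A U K)
    {z : ℂ} (hz : z ∈ resolventSet A) (y : X) :
    resolvent A z (U y) - U (resolvent A z y) = resolvent A z (K (resolvent A z y)) := by
  obtain ⟨hd, he⟩ := (resolvent_spec hz).1 y
  obtain ⟨hd', he'⟩ := h ⟨_, hd⟩
  have h1 := (resolvent_spec hz).2 ⟨_, hd'⟩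
  have h2 : z • U (resolvent A z y) - A ⟨_, hd'⟩
      = U y - K (resolvent A z y) := by
    have h3 := congrArg U he
    rw [map_sub, map_smul] at h3
    rw [he', ← h3]
    abel
  simp only [h2, map_sub] at h1
  rw [← h1]
  abel

theorem mem_domain_iff_exists_resolvent {A : X →ₗ.[ℂ] X} {z : ℂ} (hz : z ∈ resolventSet A)
    {x : X} : x ∈ A.domain ↔ ∃ y, resolvent A z y = x :=
  ⟨fun h => ⟨_, (resolvent_spec hz).2 ⟨x, h⟩⟩, fun ⟨y, hy⟩ => hy ▸ resolvent_mem_domain A z y⟩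

/-- If `A U - U A` is bounded on `D(A)` and `U D(A) ⊆ D(A)`, then `U D(A) = D(A)`. -/
theorem HasCommutator.symm_mem_domain [CompleteSpace X] {A : X →ₗ.[ℂ] X} (hA : IsNonpositive A)
    {U : X ≃L[ℂ] X} {K : X →L[ℂ] X} (h : HasCommutator A (U : X →L[ℂ] X) K) {x : X}
    (hx : x ∈ A.domain) : U.symm x ∈ A.domain := by
  have hM := nonposBound_nonneg A
  set V : X →L[ℂ] X := (U.symm : X →L[ℂ] X) with hV
  -- Any `t > ‖K‖ M_A ‖V‖` makes `‖K R(t) V‖ < 1`; the `+ 1` also makes `t` positive.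
  set t : ℝ := ‖K‖ * (nonposBound A * ‖V‖) + 1 with ht
  have htpos : 0 < t := by positivity
  have hz := hA.mem_resolventSet t htpos
  have hsmall : ‖K * resolvent A (t : ℂ) * V‖ < 1 := by
    calc ‖K * resolvent A (t : ℂ) * V‖ ≤ ‖K‖ * ‖resolvent A (t : ℂ)‖ * ‖V‖ :=
          (norm_mul_le _ _).trans (mul_le_mul_of_nonneg_right (norm_mul_le _ _) (norm_nonneg _))
      _ ≤ ‖K‖ * (nonposBound A / t) * ‖V‖ := by
          gcongr
          exact norm_resolvent_le hA htpos
      _ = ‖K‖ * (nonposBound A * ‖V‖) / t := by ring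
      _ < 1 := by
          rw [div_lt_one htpos]
          linarith
  -- With `W = 1 - K R V` invertible, the commutator identity says `U R = R W U`. Hence `R y = U (R
  -- V W⁻¹ y)`, and `U⁻¹ R y` lies in the range of `R`, which is `D(A)`.
  obtain ⟨W, hW⟩ := isUnit_one_sub_of_norm_lt_one hsmall
  have hinv : ∀ y, (W⁻¹ : (X →L[ℂ] X)ˣ).1 y - K (resolvent A (t : ℂ) (V ((W⁻¹ :
      (X →L[ℂ] X)ˣ).1 y))) = y := fun y => by
    have h1 : (W : X →L[ℂ] X) * (W⁻¹ : (X →L[ℂ] X)ˣ).1 = 1 := W.mul_inv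
    rw [hW] at h1
    simpa using congrArg (fun T : X →L[ℂ] X => T y) h1
  obtain ⟨y, rfl⟩ := (mem_domain_iff_exists_resolvent hz).1 hx
  refine (mem_domain_iff_exists_resolvent hz).2 ⟨V ((W⁻¹ : (X →L[ℂ] X)ˣ).1 y), ?_⟩
  rw [U.eq_symm_apply]
  have h2 := h.resolvent_comm hz (V ((W⁻¹ : (X →L[ℂ] X)ˣ).1 y))
  have h3 : (U : X →L[ℂ] X) (V ((W⁻¹ : (X →L[ℂ] X)ˣ).1 y)) = (W⁻¹ : (X →L[ℂ] X)ˣ).1 y := by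
    simp [hV]
  rw [h3] at h2
  have h4 := congrArg (resolvent A (t : ℂ)) (hinv y)
  rw [map_sub] at h4
  rw [← h4, ← h2]
  simp

/-- The inverse of `U` has a bounded commutator as well. -/
theorem HasCommutator.symm {A : X →ₗ.[ℂ] X} {U : X ≃L[ℂ] X} {K : X →L[ℂ] X}
    (h : HasCommutator A (U : X →L[ℂ] X) K)
    (hU : ∀ x ∈ A.domain, U.symm x ∈ A.domain) :
    HasCommutator A (U.symm : X →L[ℂ] X)
      (-((U.symm : X →L[ℂ] X) * K * (U.symm : X →L[ℂ] X))) := by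
  intro x
  refine ⟨hU x x.2, ?_⟩
  obtain ⟨hd, he⟩ := h ⟨_, hU x x.2⟩
  have h1 : A ⟨_, hd⟩ = A x := by
    congr 1
    exact Subtype.ext (U.apply_symm_apply _)
  rw [h1] at he
  have h2 := congrArg U.symm he
  simp only [ContinuousLinearEquiv.coe_coe, map_add, U.symm_apply_apply] at h2
  simp only [ContinuousLinearEquiv.coe_coe, h2]
  simp

theorem commutator_apply {T : X →ₗ.[ℂ] X} {U : X →L[ℂ] X} (x : (commutator T U).domain) :
    commutator T U x = T ⟨U x, x.2.1⟩ - U (T ⟨x, x.2.2⟩) := rfl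

/-- Under either inclusion between `U D(A)` and `D(A)`, the bounded commutator is one on all of
`D(A)`, and `U D(A) = D(A)`. -/
theorem hasCommutator_of_commutator [CompleteSpace X] {A : X →ₗ.[ℂ] X} (hA : IsNonpositive A)
    {U : X ≃L[ℂ] X} {K : X →L[ℂ] X}
    (hdom : U '' (A.domain : Set X) ⊆ A.domain ∨ (A.domain : Set X) ⊆ U '' A.domain)
    (hK : ∀ x : (commutator A (U : X →L[ℂ] X)).domain,
      commutator A (U : X →L[ℂ] X) x = K x) :
    HasCommutator A (U : X →L[ℂ] X) K ∧ ∀ x ∈ A.domain, U.symm x ∈ A.domain := by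
  have key : (∀ x ∈ A.domain, U x ∈ A.domain) → HasCommutator A (U : X →L[ℂ] X) K :=
    fun h x => ⟨h x x.2, by
      have := hK ⟨x, h x x.2, x.2⟩
      rw [commutator_apply] at this
      rw [← this]
      simp⟩
  rcases hdom with hdom | hdom
  · have h := key fun x hx => hdom ⟨x, hx, rfl⟩
    exact ⟨h, fun x => h.symm_mem_domain hA⟩
  -- The second inclusion says that `U⁻¹` preserves `D(A)`, so the Neumann series argument applies
  -- to `U⁻¹` and returns `U D(A) ⊆ D(A)`.
  · have hV : ∀ x ∈ A.domain, U.symm x ∈ A.domain := fun x hx => by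
      obtain ⟨y, hy, rfl⟩ := hdom hx
      simpa using hy
    have h : HasCommutator A (U.symm : X →L[ℂ] X)
        (-((U.symm : X →L[ℂ] X) * K * (U.symm : X →L[ℂ] X))) := by
      intro x
      refine ⟨hV x x.2, ?_⟩
      have h1 := hK ⟨U.symm x, by simp [mulBounded], hV x x.2⟩
      rw [commutator_apply] at h1
      simp only [ContinuousLinearEquiv.coe_coe, U.apply_symm_apply] at h1
      have h2 := congrArg U.symm h1
      simp only [map_sub, U.symm_apply_apply, Subtype.coe_eta] at h2
      simp [← h2]
    exact ⟨key fun x hx => by simpa using h.symm_mem_domain hA hx, hV⟩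

/-! ### Bounded commutators pass to closures -/

/-- The map `(x, y) ↦ (U x, U y + L x)` is continuous and preserves the graph, hence its closure,
which is the graph of `T.closure` by closability. -/
theorem HasCommutator.closure {T : X →ₗ.[ℂ] X} (hT : T.IsClosable) {U L : X →L[ℂ] X}
    (h : HasCommutator T U L) : HasCommutator T.closure U L := by
  have hmap : ∀ p ∈ T.closure.graph, (U p.1, U p.2 + L p.1) ∈ T.closure.graph := by
    rw [← hT.graph_closure_eq_closure_graph]
    intro p hp
    have hcont : Continuous fun p : X × X => (U p.1, U p.2 + L p.1) := by fun_prop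
    exact map_mem_closure (s := (T.graph : Set (X × X))) hcont hp fun q hq => h.mem_graph hq
  intro x
  obtain ⟨y, hy1, hy2⟩ := (LinearPMap.mem_graph_iff _).1 (hmap _ (T.closure.mem_graph x))
  have hmem : U x ∈ T.closure.domain := by
    have h1 : (y : X) = U x := hy1
    exact h1 ▸ y.2
  refine ⟨hmem, ?_⟩
  refine Eq.trans ?_ hy2
  congr 1
  exact Subtype.ext hy1.symm

theorem isClosable_of_forall_closure {T : X →ₗ.[ℂ] X}
    (h : ∀ p ∈ T.graph.topologicalClosure, p.1 = 0 → p.2 = 0) : T.IsClosable :=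
  ⟨_, (Submodule.toLinearPMap_graph_eq _ h).symm⟩

/-! ### The commutator with the Hirsch integral -/

theorem integrableOn_opResolvent {A : X →ₗ.[ℂ] X} {μ : Measure ℝ}
    (x : (hirschIntegral μ A).domain) :
    IntegrableOn (fun t : ℝ => opResolvent A t (x : X)) (Set.Ioi 0) μ := x.2.2

theorem hirschIntegral_apply {A : X →ₗ.[ℂ] X} {μ : Measure ℝ}
    (x : (hirschIntegral μ A).domain) :
    hirschIntegral μ A x = ∫ t in Set.Ioi (0 : ℝ), opResolvent A t (x : X) ∂μ := rfl

/-- Composing with `S = R(1, A)` makes the operator bounded: `S A R(t) x = R(t) A S x`, where `A S =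
S - 1` is bounded and `‖R(t)‖ ≤ M_A / t` is `μ`-integrable. So `‖S y‖ ≤ C ‖x‖` on the closure of the
graph, and `x = 0` forces `S y = 0`, hence `y = 0`. -/
theorem isClosable_hirschIntegral [CompleteSpace X] {A : X →ₗ.[ℂ] X} (hA : IsNonpositive A)
    {μ : Measure ℝ} (hμ : IntegrableOn (fun t : ℝ => 1 / t) (Set.Ioi 0) μ) :
    (hirschIntegral μ A).IsClosable := by
  have h1 := hA.mem_resolventSet 1 one_pos
  set S := resolvent A ((1 : ℝ) : ℂ) with hS
  set M := nonposBound A with hM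
  set d := ∫ t in Set.Ioi (0 : ℝ), 1 / t ∂μ with hd
  set C := M * (‖S‖ + 1) * d with hC
  have hbound : ∀ p ∈ (hirschIntegral μ A).graph.topologicalClosure, ‖S p.2‖ ≤ C * ‖p.1‖ := by
    have hcl : IsClosed {p : X × X | ‖S p.2‖ ≤ C * ‖p.1‖} :=
      isClosed_le (by fun_prop) (by fun_prop)
    refine fun p hp => closure_minimal ?_ hcl hp
    rintro p hp
    obtain ⟨x, hx1, hx2⟩ := (LinearPMap.mem_graph_iff _).1 hp
    simp only [Set.mem_ofPred_eq]
    rw [← hx1, ← hx2, hirschIntegral_apply, ← S.integral_comp_comm (integrableOn_opResolvent x)]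
    have hAS : ∀ y, ‖A ⟨S y, resolvent_mem_domain A _ y⟩‖ ≤ (‖S‖ + 1) * ‖y‖ := fun y => by
      have := opResolvent_eq h1 y
      rw [opResolvent_apply] at this
      rw [this]
      refine (norm_sub_le _ _).trans ?_
      rw [Complex.ofReal_one, one_smul, add_mul, one_mul]
      have := S.le_opNorm y
      rw [hS, Complex.ofReal_one] at this
      rw [hS, Complex.ofReal_one]
      gcongr
    calc ‖∫ t in Set.Ioi (0 : ℝ), S (opResolvent A t (x : X)) ∂μ‖
        ≤ ∫ t in Set.Ioi (0 : ℝ), (M * (‖S‖ + 1) * ‖(x : X)‖) * (1 / t) ∂μ := by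
          refine norm_integral_le_of_norm_le (hμ.const_mul _) ?_
          filter_upwards [ae_restrict_mem measurableSet_Ioi] with t ht
          have ht' : (0 : ℝ) < t := ht
          have hz := hA.mem_resolventSet t ht
          have hcomm : S (opResolvent A t (x : X))
              = resolvent A (t : ℂ) (A ⟨S x, resolvent_mem_domain A _ _⟩) := by
            have e1 := opResolvent_comm hz ⟨x, x.2.1⟩
            have e2 := opResolvent_comm h1 ⟨x, x.2.1⟩
            have e3 := opResolvent_apply A 1 (x : X)
            -- Resolvents commute: compare the resolvent identity with its copy in which the two
            -- points are exchanged, and cancel the nonzero factor.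
            have e4 : ∀ y, S (resolvent A (t : ℂ) y) = resolvent A (t : ℂ) (S y) := fun y => by
              by_cases h : (t : ℂ) = ((1 : ℝ) : ℂ)
              · rw [h]
              have r1 := resolvent_sub_resolvent hz h1 y
              have r2 := resolvent_sub_resolvent h1 hz y
              rw [← neg_sub, r1, ← neg_smul, neg_sub] at r2
              exact (smul_right_injective X (sub_ne_zero.2 h) r2).symm
            exact (congrArg S e1).trans ((e4 _).trans (congrArg _ (e2.symm.trans e3)))
          rw [hcomm]
          calc _ ≤ M / t * ((‖S‖ + 1) * ‖(x : X)‖) :=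
                (ContinuousLinearMap.le_opNorm _ _).trans
                  (mul_le_mul (norm_resolvent_le hA ht') (hAS _) (norm_nonneg _)
                    (div_nonneg (nonposBound_nonneg A) ht'.le))
            _ = _ := by ring
      _ = C * ‖(x : X)‖ := by
          rw [integral_const_mul, hC]
          ring
  refine isClosable_of_forall_closure fun p hp hp1 => ?_
  have h2 := hbound p hp
  rw [hp1, norm_zero, mul_zero, norm_le_zero_iff] at h2
  obtain ⟨hd1, he⟩ := (resolvent_spec h1).1 p.2
  rw [← he]
  have h3 : (⟨resolvent A ((1 : ℝ) : ℂ) p.2, hd1⟩ : A.domain) = 0 := Subtype.ext h2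
  rw [h3, LinearPMap.map_zero, ← hS, h2, smul_zero, sub_zero]

/-- The commutator of the Hirsch integral with `U`, as an integral in the operator ideal. -/
theorem exists_hasCommutator_hirschIntegral [CompleteSpace X] {A : X →ₗ.[ℂ] X}
    (hA : IsNonpositive A) (I : OperatorIdeal X) {U : X →L[ℂ] X} (K : I.Space)
    (h : HasCommutator A U (I.inclusion K)) {μ : Measure ℝ}
    (hμ₁ : Integrable (fun t : ℝ => 1 / (1 + t)) μ)
    (hμ : IntegrableOn (fun t : ℝ => 1 / t) (Set.Ioi 0) μ) :
    ∃ L : I.Space, HasCommutator (hirschIntegral μ A) U (I.inclusion L) ∧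
      ‖L‖ ≤ nonposBound A ^ 2 * (∫ t in Set.Ioi (0 : ℝ), 1 / t ∂μ) * ‖K‖ := by
  -- This is `t R K R`, the commutator of `A R(t, A) = t R - 1` with `U`, seen as an element of the
  -- ideal.
  set f : ℝ → I.Space := fun t =>
    (t : ℂ) • I.sandwich K (resolvent A (t : ℂ)) (resolvent A (t : ℂ)) with hf
  have hM := nonposBound_nonneg A
  have hcont : ContinuousOn f (Set.Ioi 0) := by
    have hR := continuousOn_resolvent_norm hA
    refine Complex.continuous_ofReal.continuousOn.smul ?_
    exact ((I.sandwich K).continuous.comp_continuousOn hR).clm_apply hR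
  have hbound : ∀ t ∈ Set.Ioi (0 : ℝ), ‖f t‖ ≤ (nonposBound A ^ 2 * ‖K‖) * (1 / t) := by
    intro t ht
    have ht' : (0 : ℝ) < t := ht
    have hR := norm_resolvent_le hA ht'
    rw [hf, norm_smul, Complex.norm_real, Real.norm_eq_abs, abs_of_pos ht']
    calc t * ‖I.sandwich K (resolvent A (t : ℂ)) (resolvent A (t : ℂ))‖
        ≤ t * (nonposBound A / t * ‖K‖ * (nonposBound A / t)) := by
          gcongr
          exact (I.norm_sandwich_le _ _ _).trans (by gcongr)
      _ = _ := by field_simp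
  have hae : ∀ᵐ t ∂(μ.restrict (Set.Ioi 0)), ‖f t‖ ≤ (nonposBound A ^ 2 * ‖K‖) * (1 / t) :=
    (ae_restrict_mem measurableSet_Ioi).mono hbound
  have hint : IntegrableOn f (Set.Ioi 0) μ :=
    Integrable.mono' (hμ.const_mul _) (hcont.aestronglyMeasurable measurableSet_Ioi) hae
  refine ⟨∫ t in Set.Ioi (0 : ℝ), f t ∂μ, fun x => ?_, ?_⟩
  · have hdom := hirschIntegral_domain hA hμ₁
    have hUx : U x ∈ (hirschIntegral μ A).domain := by
      exact (SetLike.ext_iff.1 hdom _).2 (h ⟨x, x.2.1⟩).1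
    refine ⟨hUx, ?_⟩
    have hx := integrableOn_opResolvent x
    -- Inclusion into the bounded operators followed by evaluation at `x` is continuous and linear,
    -- so it commutes with the integral taken in the ideal.
    have hev : I.inclusion (∫ t in Set.Ioi (0 : ℝ), f t ∂μ) (x : X)
        = ∫ t in Set.Ioi (0 : ℝ), I.inclusion (f t) (x : X) ∂μ :=
      (((ContinuousLinearMap.apply ℂ X (x : X)).comp I.inclusion).integral_comp_comm hint).symm
    have hint' : IntegrableOn (fun t => I.inclusion (f t) (x : X)) (Set.Ioi 0) μ :=
      ((ContinuousLinearMap.apply ℂ X (x : X)).comp I.inclusion).integrable_comp hint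
    rw [hirschIntegral_apply, hirschIntegral_apply, hev, ← U.integral_comp_comm hx,
      ← integral_add (U.integrable_comp hx) hint']
    refine setIntegral_congr_fun measurableSet_Ioi fun t ht => ?_
    have hz := hA.mem_resolventSet t ht
    have h1 := h.resolvent_comm hz (x : X)
    simp only [opResolvent_eq hz, hf, map_smul, map_sub, I.inclusion_sandwich,
      _root_.smul_apply, mul_apply_eq_comp, ← h1, smul_sub]
    abel
  · refine (norm_integral_le_of_norm_le (hμ.const_mul _) hae).trans_eq ?_
    rw [integral_const_mul]
    ring

/-! ### Typically real functions on the unit disc -/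

open ComplexConjugate Metric Real in
theorem circleAverage_conj {f : ℂ → ℂ} (hf : CircleIntegrable f 0 1) :
    circleAverage (fun z => conj (f z)) 0 1 = conj (circleAverage f 0 1) :=
  (Complex.conjCLE : ℂ →L[ℝ] ℂ).circleAverage_comp_comm hf

/-- The denominator `1 - 2 u ζ + ζ²` of the kernel of typically real functions does not vanish. -/
theorem typicallyReal_denom_ne_zero {ζ : ℂ} (hζ : ‖ζ‖ < 1) {u : ℝ} (hu : u ∈ Set.Icc (-1 : ℝ) 1) :
    1 - 2 * (u : ℂ) * ζ + ζ ^ 2 ≠ 0 := by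
  -- The roots of the quadratic are `u ± i s`, both of modulus one.
  set s := √(1 - u ^ 2) with hs
  have hs2 : s ^ 2 = 1 - u ^ 2 := Real.sq_sqrt (by nlinarith [hu.1, hu.2])
  have hn : ∀ v : ℝ, v ^ 2 = 1 - u ^ 2 → ζ - (u + v * Complex.I) ≠ 0 := fun v hv h0 => by
    have h1 : ‖ζ‖ ^ 2 = 1 := by
      rw [sub_eq_zero.1 h0, ← Complex.normSq_eq_norm_sq, Complex.normSq_add_mul_I, hv]
      ring
    nlinarith [norm_nonneg ζ]
  have h2 : (s : ℂ) ^ 2 = 1 - (u : ℂ) ^ 2 := by exact_mod_cast hs2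
  have h3 : 1 - 2 * (u : ℂ) * ζ + ζ ^ 2
      = (ζ - (u + s * Complex.I)) * (ζ - (u + (-s : ℝ) * Complex.I)) := by
    push_cast
    linear_combination (-1 : ℂ) * h2 + (s : ℂ) ^ 2 * Complex.I_sq
  rw [h3]
  exact mul_ne_zero (hn s hs2) (hn (-s) (by rw [neg_sq, hs2]))

/-! ### A Cauchy-type formula on the unit circle in terms of imaginary parts -/

section CircleFormula

open ComplexConjugate Metric Real

variable {g : ℂ → ℂ} {ζ : ℂ}

/-- The kernel reproducing `g 0 - g ζ` from the values of `g` on the unit circle. -/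
def skewKernel (ζ η : ℂ) : ℂ := 1 / (1 - ζ * η) - η / (η - ζ)

theorem one_sub_mul_ne_zero (hζ : ‖ζ‖ < 1) {η : ℂ} (hη : ‖η‖ ≤ 1) : 1 - ζ * η ≠ 0 := by
  intro h
  have h1 : ‖ζ * η‖ = 1 := by rw [← sub_eq_zero.1 h, norm_one]
  rw [norm_mul] at h1
  nlinarith [norm_nonneg ζ, norm_nonneg η]

theorem sub_ne_zero_of_norm (hζ : ‖ζ‖ < 1) {η : ℂ} (hη : ‖η‖ = 1) : η - ζ ≠ 0 := by
  intro h
  rw [sub_eq_zero.1 h] at hη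
  exact hζ.ne hη

theorem circleIntegrable_of_continuousOn {f : ℂ → ℂ} (hf : ContinuousOn f (sphere 0 1)) :
    CircleIntegrable f 0 1 :=
  hf.circleIntegrable zero_le_one

theorem continuousOn_sphere_of_diffContOnCl (hg : DiffContOnCl ℂ g (ball 0 1)) :
    ContinuousOn g (sphere 0 1) := by
  refine hg.continuousOn.mono ?_
  rw [closure_ball _ one_ne_zero]
  exact sphere_subset_closedBall

theorem continuousOn_one_div_sphere (hζ : ‖ζ‖ < 1) :
    ContinuousOn (fun η => 1 / (1 - ζ * η)) (sphere 0 1) :=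
  continuousOn_const.div (by fun_prop) fun η hη =>
    one_sub_mul_ne_zero hζ (mem_sphere_zero_iff_norm.1 hη).le

theorem continuousOn_div_sub_sphere (hζ : ‖ζ‖ < 1) :
    ContinuousOn (fun η => η / (η - ζ)) (sphere 0 1) :=
  continuousOn_id.div (by fun_prop) fun η hη =>
    sub_ne_zero_of_norm hζ (mem_sphere_zero_iff_norm.1 hη)

theorem continuousOn_skewKernel (hζ : ‖ζ‖ < 1) : ContinuousOn (skewKernel ζ) (sphere 0 1) :=
  (continuousOn_one_div_sphere hζ).sub (continuousOn_div_sub_sphere hζ)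

/-- The function `η ↦ g η / (1 - ζ η)` is holomorphic in the disc, so its mean is its value `g 0` at
the centre; the other term is the Cauchy kernel and gives `g ζ`. -/
theorem circleAverage_skewKernel_mul (hg : DiffContOnCl ℂ g (ball 0 1)) (hζ : ‖ζ‖ < 1) :
    circleAverage (fun η => skewKernel ζ η * g η) 0 1 = g 0 - g ζ := by
  have hgs := continuousOn_sphere_of_diffContOnCl hg
  have h1 : circleAverage (fun η => 1 / (1 - ζ * η) * g η) 0 1 = g 0 := by
    have hd : DiffContOnCl ℂ (fun η => (1 / (1 - ζ * η)) • g η) (ball 0 |(1 : ℝ)|) := by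
      rw [abs_one]
      refine DiffContOnCl.smul (DifferentiableOn.diffContOnCl ?_) hg
      rw [closure_ball _ one_ne_zero]
      refine DifferentiableOn.div (by fun_prop) (by fun_prop) fun η hη =>
        one_sub_mul_ne_zero hζ (mem_closedBall_zero_iff.1 hη)
    have := hd.circleAverage
    simpa using this
  have h2 : circleAverage (fun η => η / (η - ζ) * g η) 0 1 = g ζ := by
    have hg' : DiffContOnCl ℂ g (ball 0 |(1 : ℝ)|) := by rwa [abs_one]
    have := hg'.circleAverage_smul_div (w := ζ) (by simpa using hζ)
    simpa using this
  rw [← h1, ← h2, ← circleAverage_fun_sub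
    (circleIntegrable_of_continuousOn ((continuousOn_one_div_sphere hζ).fun_mul hgs))
    (circleIntegrable_of_continuousOn ((continuousOn_div_sub_sphere hζ).fun_mul hgs))]
  simp only [skewKernel, sub_mul]

/-- On the circle `η⁻¹ = conj η`, so `(1 - ζ η) (η - ζ) = η (1 - 2 ζ Re η + ζ²)`, and the numerator
is `ζ (η² - 1) = 2 i ζ η Im η`. -/
theorem skewKernel_eq (hζ : ‖ζ‖ < 1) {η : ℂ} (hη : ‖η‖ = 1) :
    skewKernel ζ η = 2 * Complex.I * η.im * (ζ / (1 - 2 * (η.re : ℂ) * ζ + ζ ^ 2)) := by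
  have h1 := one_sub_mul_ne_zero hζ hη.le
  have h2 := sub_ne_zero_of_norm hζ hη
  have hre : |η.re| ≤ 1 := hη ▸ Complex.abs_re_le_norm η
  have h3 := typicallyReal_denom_ne_zero hζ (Set.mem_Icc.2 (abs_le.1 hre))
  have h4 : (η.re : ℂ) ^ 2 + (η.im : ℂ) ^ 2 = 1 := by
    have : η.re ^ 2 + η.im ^ 2 = 1 := by
      have h := Complex.sq_norm η
      rw [hη, Complex.normSq_apply] at h
      linarith
    exact_mod_cast this
  have hη' : η = η.re + η.im * Complex.I := (Complex.re_add_im η).symm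
  rw [skewKernel, div_sub_div _ _ h1 h2, ← mul_div_assoc, div_eq_div_iff (mul_ne_zero h1 h2) h3]
  generalize η.re = a at *
  generalize η.im = b at *
  subst hη'
  have hI := Complex.I_sq
  grind

/-- On the circle the kernel is `i` times a rational function of `ζ` with real coefficients. The
sign change is what later isolates `Im g`. -/
theorem conj_skewKernel (hζ : ‖ζ‖ < 1) {η : ℂ} (hη : ‖η‖ = 1) :
    conj (skewKernel (conj ζ) η) = -skewKernel ζ η := by
  rw [skewKernel_eq hζ hη, skewKernel_eq (by rwa [RCLike.norm_conj]) hη]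
  simp only [map_mul, map_div₀, map_add, map_sub, map_pow, map_ofNat, map_one, Complex.conj_I,
    Complex.conj_ofReal, Complex.conj_conj]
  ring

/-- The reproducing formula for functions that are real on the real axis. -/
theorem circleAverage_typicallyReal (hg : DiffContOnCl ℂ g (ball 0 1))
    (hsymm : ∀ z ∈ ball (0 : ℂ) 1, g (conj z) = conj (g z)) (hζ : ‖ζ‖ < 1) :
    circleAverage (fun η => ((2 * η.im * (g η).im : ℝ) : ℂ) *
      (ζ / (1 - 2 * (η.re : ℂ) * ζ + ζ ^ 2))) 0 1 = g ζ - g 0 := by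
  have hgs := continuousOn_sphere_of_diffContOnCl hg
  have hg0 : conj (g 0) = g 0 := by simpa using (hsymm 0 (by simp)).symm
  have hζ' : ‖conj ζ‖ < 1 := by rwa [RCLike.norm_conj]
  have h1 := circleAverage_skewKernel_mul hg hζ
  -- Conjugating the formula at `conj ζ` gives the opposite value for `conj g`. Subtracting the two
  -- leaves `g - conj g = 2 i Im g` and the value `2 (g 0 - g ζ)`, whence the factor `-1/2` below.
  have h2 : circleAverage (fun η => skewKernel ζ η * conj (g η)) 0 1 = -(g 0 - g ζ) := by
    have h3 : circleAverage (fun η => conj (skewKernel (conj ζ) η * g η)) 0 1 = g 0 - g ζ := by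
      rw [circleAverage_conj (circleIntegrable_of_continuousOn
        ((continuousOn_skewKernel hζ').fun_mul hgs)), circleAverage_skewKernel_mul hg hζ', map_sub,
        hg0, hsymm ζ (by simpa using hζ), Complex.conj_conj]
    rw [← h3, ← neg_one_smul ℂ, ← circleAverage_fun_smul]
    refine circleAverage_congr_sphere fun η hη => ?_
    have hη' : ‖η‖ = 1 := by simpa using hη
    simp only [map_mul, conj_skewKernel hζ hη']
    simp
  have hconj : ContinuousOn (fun η => conj (g η)) (sphere 0 1) :=
    Complex.continuous_conj.comp_continuousOn hgs
  have h4 := circleAverage_fun_sub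
    (circleIntegrable_of_continuousOn ((continuousOn_skewKernel hζ).fun_mul hgs))
    (circleIntegrable_of_continuousOn ((continuousOn_skewKernel hζ).fun_mul hconj))
  rw [h1, h2] at h4
  have h5 : g ζ - g 0 = (-(1 / 2) : ℂ) • (g 0 - g ζ - -(g 0 - g ζ)) := by
    rw [smul_eq_mul]
    ring
  rw [h5, ← h4, ← circleAverage_fun_smul]
  refine circleAverage_congr_sphere fun η hη => ?_
  have hη' : ‖η‖ = 1 := by simpa using hη
  have h6 : g η - conj (g η) = 2 * (g η).im * Complex.I := by
    rw [Complex.sub_conj]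
    push_cast
    ring
  simp only [← mul_sub, h6, skewKernel_eq hζ hη', smul_eq_mul]
  push_cast
  linear_combination (2 * (η.im : ℂ) * (g η).im * (ζ / (1 - 2 * (η.re : ℂ) * ζ + ζ ^ 2))) *
    Complex.I_sq

end CircleFormula

/-! ### Rogosinski's representation of typically real functions -/

section TypicallyReal

open ComplexConjugate Metric Real

/-- A nonnegative weight on the circle as a finite measure in the variable `cos θ`. -/
theorem exists_finiteMeasure_cos {w : ℝ → ℝ} (hw : Continuous w) (hw0 : ∀ θ, 0 ≤ w θ) :
    ∃ σ : FiniteMeasure (Set.Icc (-1 : ℝ) 1), ∀ f : ℝ → ℂ, ContinuousOn f (Set.Icc (-1) 1) →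
      ∫ u, f (u : ℝ) ∂(σ : Measure (Set.Icc (-1 : ℝ) 1))
        = (2 * π)⁻¹ • ∫ θ in (0)..(2 * π), (w θ : ℂ) * f (cos θ) := by
  set c : ℝ → Set.Icc (-1 : ℝ) 1 := fun θ => ⟨cos θ, cos_mem_Icc θ⟩ with hc
  have hcm : Measurable c := (continuous_cos.subtype_mk _).measurable
  set ρ : ℝ → NNReal := fun θ => Real.toNNReal ((2 * π)⁻¹ * w θ) with hρ
  have hρc : Continuous ρ := continuous_real_toNNReal.comp (continuous_const.mul hw)
  set ν : Measure ℝ := (volume.restrict (Set.Ioc 0 (2 * π))).withDensity fun θ => (ρ θ : ENNReal)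
    with hν
  have hfin : IsFiniteMeasure ν := by
    refine isFiniteMeasure_withDensity ?_
    have hint : IntegrableOn (fun θ => (ρ θ : ℝ)) (Set.Ioc 0 (2 * π)) :=
      ((NNReal.continuous_coe.comp hρc).continuousOn.integrableOn_Icc).mono_set
        Set.Ioc_subset_Icc_self
    have := hint.2
    rw [hasFiniteIntegral_iff_enorm] at this
    simpa using this.ne
  refine ⟨⟨ν.map c, inferInstance⟩, fun f hf => ?_⟩
  have hfE : Continuous fun u : Set.Icc (-1 : ℝ) 1 => f u := continuousOn_iff_continuous_domRestrict.1 hf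
  rw [FiniteMeasure.toMeasure_mk, integral_map hcm.aemeasurable
    hfE.measurable.aestronglyMeasurable, hν,
    integral_withDensity_eq_integral_smul hρc.measurable,
    intervalIntegral.integral_of_le (by positivity), ← integral_smul]
  refine integral_congr_ae (Eventually.of_forall fun θ => ?_)
  have h1 : ((ρ θ : NNReal) : ℝ) = (2 * π)⁻¹ * w θ :=
    Real.coe_toNNReal _ (mul_nonneg (by positivity) (hw0 θ))
  simp only [NNReal.smul_def, h1, hc, mul_smul]
  simp

/-- A function on the unit disc preserving the sign of the imaginary part commutes with complex
conjugation. -/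
theorem conj_symm_of_im_mul_im_nonneg {G : ℂ → ℂ} (hG : DifferentiableOn ℂ G (ball 0 1))
    (him : ∀ z ∈ ball (0 : ℂ) 1, 0 ≤ z.im * (G z).im) :
    ∀ z ∈ ball (0 : ℂ) 1, G (conj z) = conj (G z) := by
  have hconjball : ∀ z ∈ ball (0 : ℂ) 1, conj z ∈ ball (0 : ℂ) 1 := fun z hz => by
    simpa using hz
  -- `Im G(x + i y)` has the sign of `y`, so letting `y → 0` from both sides gives `Im G(x) = 0`.
  have hreal : ∀ x : ℝ, (x : ℂ) ∈ ball (0 : ℂ) 1 → (G x).im = 0 := by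
    intro x hx
    have hcont : ContinuousAt (fun y : ℝ => (G (x + y * Complex.I)).im) 0 := by
      have h1 : ContinuousAt G ((fun y : ℝ => (x : ℂ) + y * Complex.I) 0) := by
        simpa using (hG.differentiableAt (isOpen_ball.mem_nhds hx)).continuousAt
      have h2 : ContinuousAt (fun y : ℝ => (x : ℂ) + y * Complex.I) 0 := by fun_prop
      exact Complex.continuous_im.continuousAt.comp
        (ContinuousAt.comp (f := fun y : ℝ => (x : ℂ) + y * Complex.I) h1 h2)
    have hev : ∀ᶠ y : ℝ in 𝓝 0, 0 ≤ y * (G (x + y * Complex.I)).im := by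
      have h2 : ContinuousAt (fun y : ℝ => (x : ℂ) + y * Complex.I) 0 := by fun_prop
      have h3 := h2.eventually_mem (isOpen_ball.mem_nhds (show (x : ℂ) + (0 : ℝ) * Complex.I ∈
        ball (0 : ℂ) 1 by simpa using hx))
      filter_upwards [h3] with y hy
      simpa using him _ hy
    have h0 : (G (x + (0 : ℝ) * Complex.I)).im = (G x).im := by simp
    have hr := hcont.tendsto.mono_left (nhdsWithin_le_nhds (s := Set.Ioi 0))
    have hl := hcont.tendsto.mono_left (nhdsWithin_le_nhds (s := Set.Iio 0))
    rw [h0] at hr hl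
    refine le_antisymm (le_of_tendsto hl ?_) (ge_of_tendsto hr ?_)
    · filter_upwards [hev.filter_mono nhdsWithin_le_nhds, self_mem_nhdsWithin] with y hy hy0
      exact nonpos_of_mul_nonneg_right hy hy0
    · filter_upwards [hev.filter_mono nhdsWithin_le_nhds, self_mem_nhdsWithin] with y hy hy0
      exact nonneg_of_mul_nonneg_right hy hy0
  have hH : DifferentiableOn ℂ (fun z => conj (G (conj z))) (ball 0 1) := fun z hz => by
    have h1 := (hG.differentiableAt (isOpen_ball.mem_nhds (hconjball z hz))).conj_conj
    simp only [Complex.conj_conj] at h1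
    exact h1.differentiableWithinAt
  -- Identity theorem: the two holomorphic functions agree on `(0, 1)`, which accumulates at `0`.
  have heq : Set.EqOn (fun z => conj (G (conj z))) G (ball 0 1) := by
    refine (hH.analyticOnNhd isOpen_ball).eqOn_of_preconnected_of_frequently_eq
      (hG.analyticOnNhd isOpen_ball) (convex_ball _ _).isPreconnected
      (mem_ball_self one_pos) ?_
    have htend : Tendsto (fun x : ℝ => (x : ℂ)) (𝓝[>] 0) (𝓝[≠] 0) := by
      refine tendsto_nhdsWithin_iff.2 ⟨?_, ?_⟩
      · exact (Complex.continuous_ofReal.tendsto' 0 0 Complex.ofReal_zero).mono_left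
          nhdsWithin_le_nhds
      · filter_upwards [self_mem_nhdsWithin] with x hx
        simpa using hx.ne'
    refine htend.frequently (Eventually.frequently ?_)
    filter_upwards [Ioo_mem_nhdsGT (one_pos (α := ℝ))] with x hx
    have hxb : (x : ℂ) ∈ ball (0 : ℂ) 1 := by
      simpa [abs_of_pos hx.1] using hx.2
    simp only [Complex.conj_ofReal]
    exact Complex.conj_eq_iff_im.2 (hreal x hxb)
  intro z hz
  have := heq (hconjball z hz)
  simp only [Complex.conj_conj] at this
  exact this.symm

theorem continuousOn_typicallyReal_kernel {ζ : ℂ} (hζ : ‖ζ‖ < 1) :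
    ContinuousOn (fun u : ℝ => ζ / (1 - 2 * (u : ℂ) * ζ + ζ ^ 2)) (Set.Icc (-1) 1) :=
  continuousOn_const.div (by fun_prop) fun _ hu => typicallyReal_denom_ne_zero hζ hu

/-- The representation on discs of radius `r < 1`. -/
theorem exists_finiteMeasure_typicallyReal_radius {G : ℂ → ℂ}
    (hG : DifferentiableOn ℂ G (ball 0 1))
    (him : ∀ z ∈ ball (0 : ℂ) 1, 0 ≤ z.im * (G z).im) {r : ℝ} (hr0 : 0 < r) (hr1 : r < 1) :
    ∃ σ : FiniteMeasure (Set.Icc (-1 : ℝ) 1), ∀ ζ : ℂ, ‖ζ‖ < 1 →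
      ∫ u, ζ / (1 - 2 * ((u : ℝ) : ℂ) * ζ + ζ ^ 2) ∂(σ : Measure (Set.Icc (-1 : ℝ) 1))
        = G (r * ζ) - G 0 := by
  -- Shrinking the disc makes `g` holomorphic up to the circle, where the weight `2 sin θ Im g` is
  -- nonnegative by the sign condition.
  set g : ℂ → ℂ := fun ζ => G (r * ζ) with hg
  have hmaps : Set.MapsTo (fun ζ : ℂ => (r : ℂ) * ζ) (closedBall 0 1) (ball 0 1) := by
    intro ζ hζ
    rw [mem_closedBall_zero_iff] at hζ
    rw [mem_ball_zero_iff, norm_mul, Complex.norm_real, Real.norm_eq_abs, abs_of_pos hr0]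
    nlinarith
  have hgd : DifferentiableOn ℂ g (closedBall 0 1) := hG.comp (by fun_prop) hmaps
  have hgc : DiffContOnCl ℂ g (ball 0 1) := by
    refine DifferentiableOn.diffContOnCl ?_
    rwa [closure_ball _ one_ne_zero]
  have hsymm : ∀ z ∈ ball (0 : ℂ) 1, g (conj z) = conj (g z) := fun z hz => by
    have := conj_symm_of_im_mul_im_nonneg hG him _ (hmaps (ball_subset_closedBall hz))
    rw [map_mul, Complex.conj_ofReal] at this
    exact this
  have hcm : ∀ θ, circleMap 0 1 θ ∈ closedBall (0 : ℂ) 1 := fun θ => by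
    simp
  have hgim : Continuous fun θ => (g (circleMap 0 1 θ)).im :=
    Complex.continuous_im.comp
      (hgd.continuousOn.comp_continuous (continuous_circleMap 0 1) hcm)
  have hre : ∀ θ, (circleMap 0 1 θ).re = cos θ := fun θ => by
    simp [circleMap, Complex.exp_ofReal_mul_I_re]
  have him' : ∀ θ, (circleMap 0 1 θ).im = sin θ := fun θ => by
    simp [circleMap, Complex.exp_ofReal_mul_I_im]
  obtain ⟨σ, hσ⟩ := exists_finiteMeasure_cos (w := fun θ => 2 * sin θ * (g (circleMap 0 1 θ)).im)
    (by fun_prop) fun θ => by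
      have h := him _ (hmaps (hcm θ))
      simp only [Complex.im_ofReal_mul, him', mul_assoc] at h
      rw [mul_assoc]
      exact mul_nonneg zero_le_two (nonneg_of_mul_nonneg_right h hr0)
  refine ⟨σ, fun ζ hζ => ?_⟩
  rw [hσ _ (continuousOn_typicallyReal_kernel hζ)]
  have h := circleAverage_typicallyReal hgc hsymm hζ
  rw [circleAverage_def] at h
  simp only [hre, him'] at h
  rw [h]
  simp [hg]

/-- **Rogosinski's representation** of typically real functions. -/
theorem exists_finiteMeasure_typicallyReal {G : ℂ → ℂ}
    (hG : DifferentiableOn ℂ G (ball 0 1))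
    (him : ∀ z ∈ ball (0 : ℂ) 1, 0 ≤ z.im * (G z).im) :
    ∃ σ : FiniteMeasure (Set.Icc (-1 : ℝ) 1), ∀ ζ : ℂ, ‖ζ‖ < 1 →
      G ζ = G 0 + ∫ u, ζ / (1 - 2 * ((u : ℝ) : ℂ) * ζ + ζ ^ 2)
        ∂(σ : Measure (Set.Icc (-1 : ℝ) 1)) := by
  have hex : ∀ r : ℝ, ∃ σ : FiniteMeasure (Set.Icc (-1 : ℝ) 1), r ∈ Set.Ioo (0 : ℝ) 1 →
      ∀ ζ : ℂ, ‖ζ‖ < 1 →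
      ∫ u, ζ / (1 - 2 * ((u : ℝ) : ℂ) * ζ + ζ ^ 2) ∂(σ : Measure (Set.Icc (-1 : ℝ) 1))
        = G (r * ζ) - G 0 := fun r => by
    by_cases hr : r ∈ Set.Ioo (0 : ℝ) 1
    · obtain ⟨σ, hσ⟩ := exists_finiteMeasure_typicallyReal_radius hG him hr.1 hr.2
      exact ⟨σ, fun _ => hσ⟩
    · exact ⟨0, fun h => absurd h hr⟩
  choose σ hσ using hex
  have hhalf : ‖(1 / 2 : ℂ)‖ < 1 := by norm_num
  obtain ⟨C, hC⟩ : ∃ C, ∀ z ∈ closedBall (0 : ℂ) (1 / 2), ‖G z - G 0‖ ≤ C := by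
    have hc : ContinuousOn (fun z => G z - G 0) (closedBall (0 : ℂ) (1 / 2)) :=
      (hG.continuousOn.mono (closedBall_subset_ball (by norm_num))).sub continuousOn_const
    exact (isCompact_closedBall _ _).exists_bound_of_continuousOn hc
  -- At `ζ = 1/2` the kernel is `(1/2) / (5/4 - u) ≥ 2/9` on `[-1, 1]`, so one value of `G` controls
  -- the mass uniformly in `r`.
  have hmass : ∀ r ∈ Set.Ioo (0 : ℝ) 1, (σ r).mass ≤ Real.toNNReal (9 / 2 * C) := by
    intro r hr
    have h1 := hσ r hr _ hhalf
    have h2 : ‖G (r * (1 / 2)) - G 0‖ ≤ C := by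
      refine hC _ ?_
      rw [mem_closedBall_zero_iff, norm_mul, Complex.norm_real, Real.norm_eq_abs,
        abs_of_pos hr.1]
      norm_num
      linarith [hr.2]
    have h3 : ∀ u : Set.Icc (-1 : ℝ) 1, (1 / 2 : ℂ) / (1 - 2 * ((u : ℝ) : ℂ) * (1 / 2)
        + (1 / 2) ^ 2) = (((1 / 2) / (5 / 4 - (u : ℝ)) : ℝ) : ℂ) := fun u => by
      push_cast
      congr 1
      ring
    simp only [h3] at h1
    rw [integral_complex_ofReal] at h1
    rw [← h1, Complex.norm_real] at h2
    have h4 : (2 / 9 : ℝ) * (σ r).mass ≤ ∫ u : Set.Icc (-1 : ℝ) 1, (1 / 2) / (5 / 4 - (u : ℝ))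
        ∂(σ r : Measure (Set.Icc (-1 : ℝ) 1)) := by
      have h5 : Integrable (fun u : Set.Icc (-1 : ℝ) 1 => (1 / 2) / (5 / 4 - (u : ℝ)))
          (σ r : Measure (Set.Icc (-1 : ℝ) 1)) := by
        have hcont : Continuous fun u : Set.Icc (-1 : ℝ) 1 => (1 / 2) / (5 / 4 - (u : ℝ)) :=
          continuous_const.div (by fun_prop) fun u => by linarith [u.2.2]
        exact hcont.integrable_of_hasCompactSupport (HasCompactSupport.of_compactSpace _)
      have h6 := integral_mono (μ := (σ r : Measure (Set.Icc (-1 : ℝ) 1)))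
        (integrable_const (2 / 9 : ℝ)) h5 fun u => by
          have hu := u.2
          simp only
          rw [le_div_iff₀ (by linarith [hu.2])]
          linarith [hu.1]
      rw [integral_const, smul_eq_mul, mul_comm] at h6
      exact h6
    rw [← NNReal.coe_le_coe, Real.coe_toNNReal', le_max_iff]
    left
    have h7 := (le_abs_self _).trans h2
    linarith
  -- Measures of bounded mass on a compact space are weakly compact, so along an ultrafilter finer
  -- than `r → 1-` the `σ r` converge without extracting a subsequence.
  set F : Ultrafilter ℝ := Ultrafilter.of (𝓝[<] 1) with hF
  have hFle : (F : Filter ℝ) ≤ 𝓝[<] 1 := Ultrafilter.of_le _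
  have hIoo : ∀ᶠ r in (F : Filter ℝ), r ∈ Set.Ioo (0 : ℝ) 1 :=
    hFle (Ioo_mem_nhdsLT one_pos)
  obtain ⟨τ, -, hτ⟩ := isCompact_iff_ultrafilter_le_nhds.1
    (isCompact_setOfPred_finiteMeasure_le_of_compactSpace (Set.Icc (-1 : ℝ) 1)
      (Real.toNNReal (9 / 2 * C))) (F.map σ) (by
        rw [le_principal_iff, Ultrafilter.mem_coe, Ultrafilter.mem_map]
        exact hIoo.mono hmass)
  have hτ' : Tendsto σ F (𝓝 τ) := hτ
  refine ⟨τ, fun ζ hζ => ?_⟩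
  have hkc : Continuous fun u : Set.Icc (-1 : ℝ) 1 => ζ / (1 - 2 * ((u : ℝ) : ℂ) * ζ + ζ ^ 2) :=
    continuousOn_iff_continuous_domRestrict.1 (continuousOn_typicallyReal_kernel hζ)
  have h1 := (FiniteMeasure.tendsto_iff_forall_integral_rclike_tendsto ℂ).1 hτ'
    (BoundedContinuousFunction.mkOfCompact ⟨_, hkc⟩)
  simp only [BoundedContinuousFunction.mkOfCompact_apply, ContinuousMap.coe_mk] at h1
  have h2 : Tendsto (fun r : ℝ => G (r * ζ) - G 0) F (𝓝 (G ζ - G 0)) := by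
    have h3 : ContinuousAt G ((fun r : ℝ => (r : ℂ) * ζ) 1) := by
      simpa using (hG.differentiableAt
        (isOpen_ball.mem_nhds (mem_ball_zero_iff.2 hζ))).continuousAt
    have h4 : ContinuousAt (fun r : ℝ => (r : ℂ) * ζ) 1 := by fun_prop
    have h5 := ((ContinuousAt.comp (f := fun r : ℝ => (r : ℂ) * ζ) h3 h4).tendsto.mono_left (hFle.trans nhdsWithin_le_nhds)).sub_const (G 0)
    simpa using h5
  have h3 := tendsto_nhds_unique (h1.congr' (hIoo.mono fun r hr => hσ r hr ζ hζ)) h2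
  rw [h3]
  ring

end TypicallyReal

/-! ### The integral representation of negative complete Bernstein functions -/

/-- The domain `ℂ \ [0, ∞)`. -/
abbrev cutPlane : Set ℂ := {z : ℂ | 0 ≤ z.re ∧ z.im = 0}ᶜ

theorem mem_cutPlane {z : ℂ} : z ∈ cutPlane ↔ z.re < 0 ∨ z.im ≠ 0 := by
  simp only [cutPlane, Set.mem_compl_iff, Set.mem_ofPred_eq, not_and_or, not_le]

theorem ofReal_mem_cutPlane {s : ℝ} (hs : s < 0) : (s : ℂ) ∈ cutPlane :=
  mem_cutPlane.2 (Or.inl (by simpa using hs))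

/-- The conformal map of the unit disc onto `ℂ \ [0, ∞)`. -/
def diskToCut (ζ : ℂ) : ℂ := -((1 - ζ) / (1 + ζ)) ^ 2

theorem one_add_ne_zero_of_norm_lt {ζ : ℂ} (hζ : ‖ζ‖ < 1) : 1 + ζ ≠ 0 := fun h => by
  rw [← neg_eq_of_add_eq_zero_right h, norm_neg, norm_one] at hζ
  exact lt_irrefl _ hζ

/-- Over the denominator `|1 + ζ|²`, the real part is `1 - |ζ|²` and the imaginary part is `-2 Im
ζ`. -/
theorem cayley_re_im {ζ : ℂ} (hζ : ‖ζ‖ < 1) :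
    0 < ((1 - ζ) / (1 + ζ)).re ∧
      ∃ c : ℝ, 0 < c ∧ ((1 - ζ) / (1 + ζ)).im = -(c * ζ.im) := by
  have h0 := Complex.normSq_pos.2 (one_add_ne_zero_of_norm_lt hζ)
  have h1 : ζ.re * ζ.re + ζ.im * ζ.im < 1 := by
    rw [← Complex.normSq_apply, Complex.normSq_eq_norm_sq]
    nlinarith [norm_nonneg ζ]
  refine ⟨?_, 2 / Complex.normSq (1 + ζ), by positivity, ?_⟩
  · rw [Complex.div_re, ← add_div]
    refine div_pos ?_ h0
    simp only [Complex.sub_re, Complex.add_re, Complex.one_re, Complex.sub_im, Complex.add_im,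
      Complex.one_im]
    nlinarith
  · rw [Complex.div_im]
    simp only [Complex.sub_re, Complex.add_re, Complex.one_re, Complex.sub_im, Complex.add_im,
      Complex.one_im]
    field_simp
    ring

/-- The sign of the imaginary part is preserved, so the condition `Im w Im φ(w) ≥ 0` transfers to
the disc. -/
theorem diskToCut_im {ζ : ℂ} (hζ : ‖ζ‖ < 1) : ∃ c : ℝ, 0 < c ∧ (diskToCut ζ).im = c * ζ.im := by
  obtain ⟨h1, c, hc, h2⟩ := cayley_re_im hζ
  refine ⟨2 * ((1 - ζ) / (1 + ζ)).re * c, by positivity, ?_⟩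
  rw [diskToCut, Complex.neg_im, sq, Complex.mul_im, h2]
  ring

theorem diskToCut_mem {ζ : ℂ} (hζ : ‖ζ‖ < 1) : diskToCut ζ ∈ cutPlane := by
  obtain ⟨h1, c, hc, h2⟩ := cayley_re_im hζ
  rw [mem_cutPlane]
  by_cases h : ζ.im = 0
  · left
    rw [diskToCut, Complex.neg_re, sq, Complex.mul_re, h2, h]
    nlinarith
  · right
    rw [diskToCut, Complex.neg_im, sq, Complex.mul_im, h2]
    have : ((1 - ζ) / (1 + ζ)).re * c * ζ.im ≠ 0 := mul_ne_zero (mul_pos h1 hc).ne' h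
    intro h'
    apply this
    linarith

/-- Off `[0, ∞)` the principal root `w` of `-z` has positive real part, and the Cayley transform, an
involution, carries it into the disc. -/
theorem exists_diskToCut {z : ℂ} (hz : z ∈ cutPlane) : ∃ ζ : ℂ, ‖ζ‖ < 1 ∧ diskToCut ζ = z := by
  set w : ℂ := (-z) ^ (2⁻¹ : ℂ) with hw
  have hw2 : w ^ 2 = -z := Complex.cpow_ofNat_inv_pow _ 2
  have hre : 0 < w.re := by
    rw [hw, Complex.cpow_inv_two_re, Real.sqrt_pos]
    have h1 : z.re < ‖z‖ := by
      rcases mem_cutPlane.1 hz with h | h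
      · exact h.trans_le (norm_nonneg _)
      · refine (le_abs_self _).trans_lt (Complex.abs_re_lt_norm.2 h)
    rw [norm_neg, Complex.neg_re]
    linarith
  have hw1 : 1 + w ≠ 0 := fun h => by
    have := congrArg Complex.re h
    simp at this
    linarith
  refine ⟨(1 - w) / (1 + w), ?_, ?_⟩
  · rw [norm_div, div_lt_one (norm_pos_iff.2 hw1), ← sq_lt_sq₀ (norm_nonneg _) (norm_nonneg _),
      ← Complex.normSq_eq_norm_sq, ← Complex.normSq_eq_norm_sq, Complex.normSq_apply,
      Complex.normSq_apply]
    simp only [Complex.sub_re, Complex.add_re, Complex.one_re, Complex.sub_im, Complex.add_im,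
      Complex.one_im]
    nlinarith
  · have h2 : (1 - (1 - w) / (1 + w)) / (1 + (1 - w) / (1 + w)) = w := by
      field_simp
      ring
    rw [diskToCut, h2, hw2, neg_neg]

theorem differentiableOn_diskToCut : DifferentiableOn ℂ diskToCut (Metric.ball 0 1) := by
  refine DifferentiableOn.neg (DifferentiableOn.pow (DifferentiableOn.div (by fun_prop)
    (by fun_prop) fun ζ hζ => ?_) 2)
  exact one_add_ne_zero_of_norm_lt (mem_ball_zero_iff.1 hζ)

theorem diskToCut_zero : diskToCut 0 = -1 := by
  simp [diskToCut]

theorem denom_ne_zero_of_mem_cutPlane {z : ℂ} (hz : z ∈ cutPlane) {v : ℝ}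
    (hv : v ∈ Set.Icc (0 : ℝ) 1) : (1 - (v : ℂ)) - v * z ≠ 0 := by
  intro h
  have hr := congrArg Complex.re h
  have hi := congrArg Complex.im h
  simp at hr hi
  rcases mem_cutPlane.1 hz with h1 | h1
  · rcases eq_or_lt_of_le hv.1 with h2 | h2
    · rw [← h2] at hr
      norm_num at hr
    · nlinarith [hv.2]
  · rcases hi with hi | hi
    · rw [hi] at hr
      norm_num at hr
    · exact h1 hi

/-- With `z = diskToCut ζ` and `v = (1 + u) / 2`, one has `1 + z = 4 ζ / (1 + ζ)²` and `1 - v - v z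
= (1 - 2 u ζ + ζ²) / (1 + ζ)²`. -/
theorem typicallyReal_kernel_eq {ζ : ℂ} (hζ : ‖ζ‖ < 1) {u : ℝ} (hu : u ∈ Set.Icc (-1 : ℝ) 1) :
    ζ / (1 - 2 * (u : ℂ) * ζ + ζ ^ 2) = (1 / 4 : ℝ) • ((1 + diskToCut ζ) /
      ((1 - (((1 + u) / 2 : ℝ) : ℂ)) - ((1 + u) / 2 : ℝ) * diskToCut ζ)) := by
  have h1 := one_add_ne_zero_of_norm_lt hζ
  have h2 := typicallyReal_denom_ne_zero hζ hu
  have h3 := denom_ne_zero_of_mem_cutPlane (diskToCut_mem hζ) (v := (1 + u) / 2)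
    ⟨by linarith [hu.1], by linarith [hu.2]⟩
  rw [Complex.real_smul, ← mul_div_assoc, div_eq_div_iff h2 h3, diskToCut]
  push_cast
  field_simp
  ring

/-- The representation by a finite measure on the compactification `[0, 1]` of `[0, ∞]`. -/
theorem NegCompleteBernstein.exists_finite_measure {φ : ℂ → ℂ} (hφ : NegCompleteBernstein φ) :
    ∃ ν : Measure ℝ, IsFiniteMeasure ν ∧ (∀ᵐ v ∂ν, v ∈ Set.Icc (0 : ℝ) 1) ∧
      ∀ z ∈ cutPlane, φ z = φ (-1) + ∫ v : ℝ, (1 + z) / ((1 - (v : ℂ)) - v * z) ∂ν := by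
  have hG : DifferentiableOn ℂ (φ ∘ diskToCut) (Metric.ball 0 1) :=
    hφ.differentiableOn.comp differentiableOn_diskToCut fun ζ hζ =>
      diskToCut_mem (mem_ball_zero_iff.1 hζ)
  obtain ⟨σ, hσ⟩ := exists_finiteMeasure_typicallyReal hG fun ζ hζ => by
    have hζ' := mem_ball_zero_iff.1 hζ
    obtain ⟨c, hc, h1⟩ := diskToCut_im hζ'
    have h2 := hφ.im_mul_im_nonneg _ (diskToCut_mem hζ')
    rw [h1, mul_assoc] at h2
    exact nonneg_of_mul_nonneg_right h2 hc
  have hm : Measurable fun u : Set.Icc (-1 : ℝ) 1 => (1 + (u : ℝ)) / 2 := by fun_prop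
  refine ⟨(1 / 4 : NNReal) • (σ : Measure (Set.Icc (-1 : ℝ) 1)).map
    fun u : Set.Icc (-1 : ℝ) 1 => (1 + (u : ℝ)) / 2, inferInstance, ?_, ?_⟩
  · refine Measure.ae_smul_measure ?_ _
    refine (ae_map_iff (p := fun v => v ∈ Set.Icc (0 : ℝ) 1) hm.aemeasurable
      measurableSet_Icc).2 (Eventually.of_forall fun u => ⟨by linarith [u.2.1], by linarith [u.2.2]⟩)
  · intro z hz
    obtain ⟨ζ, hζ, rfl⟩ := exists_diskToCut hz
    have h := hσ ζ hζ
    simp only [Function.comp_apply, diskToCut_zero] at h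
    rw [h, integral_smul_nnreal_measure, integral_map hm.aemeasurable
      (by fun_prop : Measurable _).aestronglyMeasurable, NNReal.smul_def,
      ← integral_smul]
    congr 1
    refine integral_congr_ae (Eventually.of_forall fun u => ?_)
    simp only [typicallyReal_kernel_eq hζ u.2]
    norm_num

/-- A nonnegative sequence below its pointwise limit whose integrals converge to `d`: the limit
is integrable with integral `d`. -/
theorem integrable_and_integral_eq_of_tendsto {μ : Measure ℝ} {f : ℕ → ℝ → ℝ} {g : ℝ → ℝ} {d : ℝ}
    (hf : ∀ n, Integrable (f n) μ) (h0 : ∀ n, ∀ᵐ x ∂μ, 0 ≤ f n x)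
    (hle : ∀ n, ∀ᵐ x ∂μ, f n x ≤ g x)
    (hlim : ∀ᵐ x ∂μ, Tendsto (fun n => f n x) atTop (𝓝 (g x)))
    (hd : Tendsto (fun n => ∫ x, f n x ∂μ) atTop (𝓝 d)) :
    Integrable g μ ∧ ∫ x, g x ∂μ = d := by
  have hg : Integrable g μ := by
    -- Fatou's lemma gives integrability of the limit, which then serves as its own dominating
    -- function.
    refine integrable_of_tendsto hlim (fun n => (hf n).aestronglyMeasurable) ?_
    have h1 : ∀ n, ∫⁻ x, ‖f n x‖ₑ ∂μ = ENNReal.ofReal (∫ x, f n x ∂μ) := fun n => by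
      rw [ofReal_integral_eq_lintegral_ofReal (hf n) (h0 n)]
      refine lintegral_congr_ae ((h0 n).mono fun x hx => ?_)
      exact Real.enorm_of_nonneg hx
    simp only [h1]
    have h2 : Tendsto (fun n => ENNReal.ofReal (∫ x, f n x ∂μ)) atTop (𝓝 (ENNReal.ofReal d)) :=
      (ENNReal.continuous_ofReal.tendsto d).comp hd
    rw [h2.liminf_eq]
    exact ENNReal.ofReal_ne_top
  refine ⟨hg, tendsto_nhds_unique ?_ hd⟩
  refine tendsto_integral_of_dominated_convergence g (fun n => (hf n).aestronglyMeasurable) hg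
    (fun n => ?_) hlim
  filter_upwards [h0 n, hle n] with x hx0 hx
  rwa [Real.norm_of_nonneg hx0]

/-- The kernel on `[0, 1]` is bounded, hence integrable. -/
theorem integrable_cutKernel {ν : Measure ℝ} [IsFiniteMeasure ν]
    (hν : ∀ᵐ v ∂ν, v ∈ Set.Icc (0 : ℝ) 1) {z : ℂ} (hz : z ∈ cutPlane) :
    Integrable (fun v : ℝ => (1 + z) / ((1 - (v : ℂ)) - v * z)) ν := by
  have hc : ContinuousOn (fun v : ℝ => (1 + z) / ((1 - (v : ℂ)) - v * z)) (Set.Icc 0 1) :=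
    continuousOn_const.div (by fun_prop) fun v hv => denom_ne_zero_of_mem_cutPlane hz hv
  have := hc.integrableOn_compact (μ := ν) isCompact_Icc
  rwa [IntegrableOn, Measure.restrict_eq_self_of_ae_mem hν] at this

/-- A sequence increasing to `-0`. -/
theorem tendsto_neg_one_div_nhdsLT :
    Tendsto (fun n : ℕ => -(1 / ((n : ℝ) + 2))) atTop (𝓝[<] 0) := by
  refine tendsto_nhdsWithin_iff.2 ⟨?_, Eventually.of_forall fun n => ?_⟩
  · have h1 : Tendsto (fun n : ℕ => (n : ℝ) + 2) atTop atTop :=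
      tendsto_atTop_add_const_right _ _ tendsto_natCast_atTop_atTop
    have h2 := (tendsto_inv_atTop_zero.comp h1).neg
    simpa [one_div] using h2
  · have : (0 : ℝ) < (n : ℝ) + 2 := by positivity
    simp only [Set.mem_Iio, Left.neg_neg_iff]
    positivity

/-! ### Removing the endpoint atoms by means of `c = b = 0` -/

section Normalization

variable {φ : ℂ → ℂ} {ν : Measure ℝ} [IsFiniteMeasure ν]

/-- If `φ(-0) = 0`, the measure on `[0, 1]` integrates `1 / (1 - v)`, and this integral
is `-φ(-1)`. -/
theorem integrable_one_div_one_sub (hν : ∀ᵐ v ∂ν, v ∈ Set.Icc (0 : ℝ) 1)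
    (hrep : ∀ z ∈ cutPlane, φ z = φ (-1) + ∫ v : ℝ, (1 + z) / ((1 - (v : ℂ)) - v * z) ∂ν)
    (hc : Tendsto (fun s : ℝ => φ (s : ℂ)) (𝓝[<] 0) (𝓝 0)) :
    (∀ᵐ v ∂ν, v ∈ Set.Ico (0 : ℝ) 1) ∧ Integrable (fun v : ℝ => 1 / (1 - v)) ν ∧
      ((∫ v : ℝ, 1 / (1 - v) ∂ν : ℝ) : ℂ) = -φ (-1) := by
  -- The shift by `2` keeps `s n > -1`, so that the numerator `1 + s n` of the kernel is positive.
  set s : ℕ → ℝ := fun n => -(1 / ((n : ℝ) + 2)) with hs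
  have hst : Tendsto s atTop (𝓝[<] 0) := tendsto_neg_one_div_nhdsLT
  have hst0 : Tendsto s atTop (𝓝 0) := hst.mono_right nhdsWithin_le_nhds
  have hs0 : ∀ n, s n < 0 := fun n => by
    simp only [hs, Left.neg_neg_iff]
    positivity
  have hs1 : ∀ n, 0 < 1 + s n := fun n => by
    have : 1 / ((n : ℝ) + 2) < 1 := by
      rw [div_lt_one (by positivity)]
      linarith [(Nat.cast_nonneg n : (0 : ℝ) ≤ n)]
    simp only [hs]
    linarith
  set f : ℕ → ℝ → ℝ := fun n v => (1 + s n) / ((1 - v) - v * s n) with hf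
  have hfc : ∀ n v, ((f n v : ℝ) : ℂ) = (1 + (s n : ℂ)) / ((1 - (v : ℂ)) - v * (s n : ℂ)) :=
    fun n v => by simp [hf]
  have hint : ∀ n, Integrable (f n) ν := fun n => by
    have := (integrable_cutKernel hν (ofReal_mem_cutPlane (hs0 n))).re
    refine this.congr (Eventually.of_forall fun v => ?_)
    simp only [← hfc]
    simp
  have hpos : ∀ n, ∀ v ∈ Set.Icc (0 : ℝ) 1, 0 < (1 - v) - v * s n := fun n v hv => by
    rcases eq_or_lt_of_le hv.1 with h | h
    · rw [← h]
      norm_num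
    · nlinarith [hs0 n, hv.2]
  have hf0 : ∀ n, ∀ᵐ v ∂ν, 0 ≤ f n v := fun n => hν.mono fun v hv =>
    div_nonneg (hs1 n).le (hpos n v hv).le
  have hlimC : Tendsto (fun n => ((∫ v, f n v ∂ν : ℝ) : ℂ)) atTop (𝓝 (-φ (-1))) := by
    have h1 := (hc.comp hst).sub_const (φ (-1))
    rw [zero_sub] at h1
    refine h1.congr fun n => ?_
    rw [Function.comp_apply, hrep _ (ofReal_mem_cutPlane (hs0 n)), add_sub_cancel_left,
      ← integral_complex_ofReal]
    simp only [hfc]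
  have hlim : Tendsto (fun n => ∫ v, f n v ∂ν) atTop (𝓝 (-φ (-1)).re) := by
    have := (Complex.continuous_re.tendsto _).comp hlimC
    simpa [Function.comp_def] using this
  have hreal : (((-φ (-1)).re : ℝ) : ℂ) = -φ (-1) :=
    tendsto_nhds_unique ((Complex.continuous_ofReal.tendsto _).comp hlim) hlimC
  -- At `v = 1` the kernel equals `(1 + s) / (-s)`, which blows up as `s → -0` while the integrals
  -- converge; Markov's inequality excludes an atom.
  have hν1 : ν {1} = 0 := by
    have h1 : ∀ n, ν.real {1} ≤ (-s n / (1 + s n)) * ∫ v, f n v ∂ν := fun n => by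
      have h2 := mul_meas_ge_le_integral_of_nonneg (hf0 n) (hint n) (f n 1)
      have h3 : f n 1 = (1 + s n) / (-s n) := by simp [hf]
      have h4 : ν.real {1} ≤ ν.real {x | f n 1 ≤ f n x} :=
        measureReal_mono (Set.singleton_subset_iff.2 (le_refl (f n 1)))
      have h5 : 0 < f n 1 := h3 ▸ div_pos (hs1 n) (neg_pos.2 (hs0 n))
      have h6 : (-s n / (1 + s n)) = (f n 1)⁻¹ := by rw [h3, inv_div]
      rw [h6, inv_mul_eq_div, le_div_iff₀ h5, mul_comm]
      exact (mul_le_mul_of_nonneg_left h4 h5.le).trans h2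
    have h2 : Tendsto (fun n => (-s n / (1 + s n)) * ∫ v, f n v ∂ν) atTop
        (𝓝 ((-0 / (1 + 0)) * (-φ (-1)).re)) :=
      (hst0.neg.div (hst0.const_add 1) (by norm_num)).mul hlim
    have h3 := ge_of_tendsto' h2 h1
    rw [neg_zero, zero_div, zero_mul] at h3
    exact (measureReal_eq_zero_iff).1 (le_antisymm h3 measureReal_nonneg)
  have hν' : ∀ᵐ v ∂ν, v ∈ Set.Ico (0 : ℝ) 1 := by
    have h1 : ∀ᵐ v ∂ν, v ≠ 1 := by
      rw [ae_iff]
      simpa using hν1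
    filter_upwards [hν, h1] with v hv hv1
    exact ⟨hv.1, lt_of_le_of_ne hv.2 hv1⟩
  obtain ⟨h1, h2⟩ := integrable_and_integral_eq_of_tendsto (g := fun v => 1 / (1 - v)) hint hf0
    (fun n => hν'.mono fun v hv => by
      have := hpos n v ⟨hv.1, hv.2.le⟩
      rw [div_le_div_iff₀ this (by linarith [hv.2])]
      nlinarith [hs0 n])
    (hν'.mono fun v hv => by
      have h1 : Tendsto (fun n => (1 + s n) / ((1 - v) - v * s n)) atTop
          (𝓝 ((1 + 0) / ((1 - v) - v * 0))) :=
        (hst0.const_add 1).div ((hst0.const_mul v).const_sub _)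
          (by simp only [mul_zero, sub_zero]; linarith [hv.2])
      simpa using h1) hlim
  exact ⟨hν', h1, by rw [h2, hreal]⟩

/-- Insert `φ(-1) = -∫ dν(v) / (1 - v)` and use `(1 + z) (1 - v) - (1 - v - v z) = z`. -/
theorem eq_integral_of_limit_zero (hν : ∀ᵐ v ∂ν, v ∈ Set.Icc (0 : ℝ) 1)
    (hrep : ∀ z ∈ cutPlane, φ z = φ (-1) + ∫ v : ℝ, (1 + z) / ((1 - (v : ℂ)) - v * z) ∂ν)
    (hc : Tendsto (fun s : ℝ => φ (s : ℂ)) (𝓝[<] 0) (𝓝 0)) {z : ℂ} (hz : z ∈ cutPlane) :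
    φ z = ∫ v : ℝ, z / (((1 - (v : ℂ)) - v * z) * (1 - v)) ∂ν := by
  obtain ⟨hν', hint, heq⟩ := integrable_one_div_one_sub hν hrep hc
  have h1 : φ (-1) = -∫ v : ℝ, ((1 / (1 - v) : ℝ) : ℂ) ∂ν := by
    rw [integral_complex_ofReal, heq, neg_neg]
  have hint' : Integrable (fun v : ℝ => ((1 / (1 - v) : ℝ) : ℂ)) ν := hint.ofReal
  rw [hrep z hz, h1, neg_add_eq_sub, ← integral_sub (integrable_cutKernel hν hz) hint']
  refine integral_congr_ae (hν'.mono fun v hv => ?_)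
  have h2 := denom_ne_zero_of_mem_cutPlane hz ⟨hv.1, hv.2.le⟩
  have h3 : (1 : ℂ) - v ≠ 0 := by
    have : (1 : ℝ) - v ≠ 0 := by linarith [hv.2]
    exact_mod_cast this
  push_cast
  rw [div_sub_div _ _ h2 h3]
  congr 1
  ring

/-- If moreover `φ(s) / s → 0` at `-∞`, the measure has no mass at `0`. -/
theorem ae_mem_Ioo_of_limits (hν : ∀ᵐ v ∂ν, v ∈ Set.Icc (0 : ℝ) 1)
    (hrep : ∀ z ∈ cutPlane, φ z = φ (-1) + ∫ v : ℝ, (1 + z) / ((1 - (v : ℂ)) - v * z) ∂ν)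
    (hc : Tendsto (fun s : ℝ => φ (s : ℂ)) (𝓝[<] 0) (𝓝 0))
    (hb : Tendsto (fun s : ℝ => φ (s : ℂ) / (s : ℂ)) atBot (𝓝 0)) :
    ∀ᵐ v ∂ν, v ∈ Set.Ioo (0 : ℝ) 1 := by
  obtain ⟨hν', hint, -⟩ := integrable_one_div_one_sub hν hrep hc
  set s : ℕ → ℝ := fun n => -((n : ℝ) + 1) with hs
  have hsb : Tendsto s atTop atBot :=
    tendsto_neg_atTop_atBot.comp (tendsto_atTop_add_const_right _ _ tendsto_natCast_atTop_atTop)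
  have hs1 : ∀ n, s n ≤ -1 := fun n => by
    simp only [hs]
    linarith [(Nat.cast_nonneg n : (0 : ℝ) ≤ n)]
  have hval : ∀ n, φ (s n) / s n = ((∫ v, 1 / (((1 - v) - v * s n) * (1 - v)) ∂ν : ℝ) : ℂ) :=
    fun n => by
      have hne : (s n : ℂ) ≠ 0 := by
        have : s n ≠ 0 := by linarith [hs1 n]
        exact_mod_cast this
      rw [eq_integral_of_limit_zero hν hrep hc (ofReal_mem_cutPlane (by linarith [hs1 n])),
        ← integral_complex_ofReal, ← integral_div]
      refine integral_congr_ae (Eventually.of_forall fun v => ?_)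
      simp only
      push_cast
      rw [div_right_comm, div_self hne]
  -- For `s ≤ -1` the factor `1 - v - v s` is at least `1`, so `1 / (1 - v)` dominates; the
  -- pointwise limit is `1` at `v = 0` and `0` elsewhere. Thus `lim φ(s) / s = ν {0}`.
  have hlim : Tendsto (fun n => ∫ v, 1 / (((1 - v) - v * s n) * (1 - v)) ∂ν) atTop
      (𝓝 (∫ v, Set.indicator {0} (1 : ℝ → ℝ) v ∂ν)) := by
    refine tendsto_integral_of_dominated_convergence (fun v => 1 / (1 - v))
      (fun n => (by fun_prop : Measurable _).aestronglyMeasurable) hint (fun n => ?_) ?_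
    · filter_upwards [hν'] with v hv
      have h1 : 1 ≤ (1 - v) - v * s n := by nlinarith [hs1 n, hv.1]
      have h2 : 0 < 1 - v := by linarith [hv.2]
      rw [Real.norm_of_nonneg (by positivity)]
      exact one_div_le_one_div_of_le h2 (le_mul_of_one_le_left h2.le h1)
    · filter_upwards [hν'] with v hv
      rcases eq_or_lt_of_le hv.1 with h | h
      · simp [← h]
      · rw [Set.indicator_of_notMem (by simpa using h.ne')]
        have h2 : 0 < 1 - v := by linarith [hv.2]
        have h3 : Tendsto (fun n => ((1 - v) - v * s n) * (1 - v)) atTop atTop := by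
          refine Tendsto.atTop_mul_const h2 ?_
          have h4 : Tendsto (fun n => v * -s n) atTop atTop :=
            (tendsto_neg_atBot_atTop.comp hsb).const_mul_atTop h
          have h5 := tendsto_atTop_add_const_left _ (1 - v) h4
          refine h5.congr fun n => by ring
        simpa only [one_div, Function.comp_def] using tendsto_inv_atTop_zero.comp h3
  have h0 : ∫ v, Set.indicator {0} (1 : ℝ → ℝ) v ∂ν = 0 := by
    have h1 := (Complex.continuous_ofReal.tendsto _).comp hlim
    have h2 := hb.comp hsb
    have h3 := tendsto_nhds_unique (h1.congr fun n => (hval n).symm) h2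
    exact_mod_cast h3
  rw [integral_indicator_one (measurableSet_singleton 0), measureReal_eq_zero_iff] at h0
  have h1 : ∀ᵐ v ∂ν, v ≠ 0 := by
    rw [ae_iff]
    simpa using h0
  filter_upwards [hν', h1] with v hv hv0
  exact ⟨lt_of_le_of_ne hv.1 hv0.symm, hv.2⟩

end Normalization

/-- A function of class `OM₋` with vanishing constant and linear terms has a representing
measure. -/
theorem NegCompleteBernstein.exists_isRepresentingMeasure {φ : ℂ → ℂ}
    (hφ : NegCompleteBernstein φ)
    (hc : Tendsto (fun s : ℝ => φ (s : ℂ)) (𝓝[<] 0) (𝓝 0))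
    (hb : Tendsto (fun s : ℝ => φ (s : ℂ) / (s : ℂ)) atBot (𝓝 0)) :
    ∃ μ : Measure ℝ, IsRepresentingMeasure φ μ := by
  obtain ⟨ν, hfin, hν, hrep⟩ := hφ.exists_finite_measure
  obtain ⟨-, hint, -⟩ := integrable_one_div_one_sub hν hrep hc
  have hν' := ae_mem_Ioo_of_limits hν hrep hc hb
  set T : ℝ → ℝ := fun v => (1 - v) / v with hT
  have hTm : Measurable T := by fun_prop
  -- With `t = (1 - v) / v` one has `t - z = (1 - v - v z) / v` and `1 / (1 + t) = v`. This density
  -- therefore turns `z / (t - z)` into the kernel in `v`, and `1 / (1 + t)` into the integrable `1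
  -- / (1 - v)`.
  set ρ : ℝ → NNReal := fun v => Real.toNNReal (1 / (v * (1 - v))) with hρ
  have hρm : Measurable ρ := by fun_prop
  have hρv : ∀ v ∈ Set.Ioo (0 : ℝ) 1, (ρ v : ℝ) = 1 / (v * (1 - v)) := fun v hv =>
    Real.coe_toNNReal _ (by
      have h1 := hv.1
      have h2 : 0 < 1 - v := by linarith [hv.2]
      positivity)
  set μ : Measure ℝ := (ν.withDensity fun v => (ρ v : ENNReal)).map T with hμ
  have hsupp : μ (Set.Iic 0) = 0 := by
    rw [hμ, Measure.map_apply hTm measurableSet_Iic]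
    refine withDensity_absolutelyContinuous _ _ ?_
    have : ∀ᵐ v ∂ν, ¬ v ∈ T ⁻¹' Set.Iic 0 := hν'.mono fun v hv => by
      have : 0 < T v := div_pos (by linarith [hv.2]) hv.1
      simpa using this
    rw [ae_iff] at this
    simpa only [not_not, Set.ofPred_mem_eq] using this
  refine ⟨μ, hsupp, ?_, fun z hz => ?_⟩
  · rw [hμ, integrable_map_measure (by fun_prop : Measurable _).aestronglyMeasurable
      hTm.aemeasurable, integrable_withDensity_iff_integrable_coe_smul hρm]
    refine hint.congr (hν'.mono fun v hv => ?_)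
    have h1 : v ≠ 0 := hv.1.ne'
    have h2 : 1 - v ≠ 0 := by linarith [hv.2]
    have h3 : 1 + (1 - v) / v = 1 / v := by
      field_simp
      ring
    simp only [Function.comp_apply, hρv v hv, hT, h3, smul_eq_mul]
    field_simp
  · have hrestrict : μ.restrict (Set.Ioi 0) = μ := by
      refine Measure.restrict_eq_self_of_ae_mem ?_
      rw [ae_iff]
      simpa [Set.Iic] using hsupp
    rw [hrestrict, hμ, integral_map hTm.aemeasurable
      (by fun_prop : Measurable _).aestronglyMeasurable,
      integral_withDensity_eq_integral_smul hρm, eq_integral_of_limit_zero hν hrep hc hz]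
    refine integral_congr_ae (hν'.mono fun v hv => ?_)
    have h1 : (v : ℂ) ≠ 0 := by exact_mod_cast hv.1.ne'
    have h2 : (1 : ℂ) - v ≠ 0 := by
      have : (1 : ℝ) - v ≠ 0 := by linarith [hv.2]
      exact_mod_cast this
    have h3 := denom_ne_zero_of_mem_cutPlane hz ⟨hv.1.le, hv.2.le⟩
    have h4 : (T v : ℂ) - z = ((1 - (v : ℂ)) - v * z) / v := by
      simp only [hT]
      push_cast
      field_simp
    simp only [NNReal.smul_def, hρv v hv, h4, Complex.real_smul]
    push_cast
    field_simp

/-- Any representing measure serves: the later arguments use only its defining properties, not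
uniqueness. -/
theorem isRepresentingMeasure_representingMeasure {φ : ℂ → ℂ}
    (h : ∃ μ : Measure ℝ, IsRepresentingMeasure φ μ) :
    IsRepresentingMeasure φ (representingMeasure φ) := by
  rw [representingMeasure, dif_pos h]
  exact h.choose_spec

/-! ### The derivative at `-0` -/

/-- A function continuous up to an endpoint whose derivative has a limit there has that limit as
one-sided derivative; `φ(s) / s` is the slope at `0`. -/
theorem tendsto_div_of_tendsto_deriv {φ : ℂ → ℂ} (hφ : DifferentiableOn ℂ φ cutPlane)
    (hc : Tendsto (fun s : ℝ => φ (s : ℂ)) (𝓝[<] 0) (𝓝 0)) {d : ℂ}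
    (hd : Tendsto (fun s : ℝ => deriv φ (s : ℂ)) (𝓝[<] 0) (𝓝 d)) :
    Tendsto (fun s : ℝ => φ (s : ℂ) / (s : ℂ)) (𝓝[<] 0) (𝓝 d) := by
  have hopen : IsOpen cutPlane := by
    have : IsClosed {z : ℂ | 0 ≤ z.re ∧ z.im = 0} :=
      (isClosed_le continuous_const Complex.continuous_re).inter
        (isClosed_eq Complex.continuous_im continuous_const)
    exact this.isOpen_compl
  -- The point `0` lies on the cut, so `φ 0` is arbitrary and is replaced by the limit.
  set f : ℝ → ℂ := Function.update (fun s : ℝ => φ (s : ℂ)) 0 0 with hf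
  have hderiv : ∀ s : ℝ, s < 0 → HasDerivAt f (deriv φ (s : ℂ)) s := fun s hs => by
    have h1 : HasDerivAt φ (deriv φ (s : ℂ)) (s : ℂ) :=
      (hφ.differentiableAt (hopen.mem_nhds (ofReal_mem_cutPlane hs))).hasDerivAt
    refine h1.comp_ofReal.congr_of_eventuallyEq ?_
    filter_upwards [isOpen_ne.mem_nhds hs.ne] with t ht
    exact Function.update_of_ne ht _ _
  have hcont : ContinuousWithinAt f (Set.Iio 0) 0 := by
    rw [ContinuousWithinAt, hf, Function.update_self]
    refine hc.congr' ?_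
    filter_upwards [self_mem_nhdsWithin] with t ht
    exact (Function.update_of_ne (Set.mem_Iio.1 ht).ne (0 : ℂ) (fun s : ℝ => φ (s : ℂ))).symm
  have h := hasDerivWithinAt_Iic_of_tendsto_deriv (f := f) (s := Set.Iio 0) (e := d) (a := 0)
    (fun s hs => (hderiv s hs).differentiableAt.differentiableWithinAt) hcont self_mem_nhdsWithin
    (hd.congr' (by
      filter_upwards [self_mem_nhdsWithin] with s hs
      exact (hderiv s hs).deriv.symm))
  rw [hasDerivWithinAt_iff_tendsto_slope, Set.Iic_sdiff_right] at h
  refine h.congr' ?_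
  filter_upwards [self_mem_nhdsWithin] with s hs
  rw [slope_def_module, hf, Function.update_self, Function.update_of_ne (Set.mem_Iio.1 hs).ne, sub_zero,
    sub_zero, Complex.real_smul, Complex.ofReal_inv, inv_mul_eq_div]

/-- On the negative axis `φ(s) / s = ∫ dμ(t) / (t - s)`, whose integrand increases to `1 / t` as `s
→ -0`. This identifies the constant in the norm bound with `φ'(-0)`. -/
theorem IsRepresentingMeasure.integral_one_div {φ : ℂ → ℂ} {μ : Measure ℝ}
    (h : IsRepresentingMeasure φ μ) {d : ℝ}
    (hd : Tendsto (fun s : ℝ => φ (s : ℂ) / (s : ℂ)) (𝓝[<] 0) (𝓝 (d : ℂ))) :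
    IntegrableOn (fun t : ℝ => 1 / t) (Set.Ioi 0) μ ∧
      ∫ t in Set.Ioi (0 : ℝ), 1 / t ∂μ = d := by
  set s : ℕ → ℝ := fun n => -(1 / ((n : ℝ) + 2)) with hs
  have hst : Tendsto s atTop (𝓝[<] 0) := tendsto_neg_one_div_nhdsLT
  have hst0 : Tendsto s atTop (𝓝 0) := hst.mono_right nhdsWithin_le_nhds
  have hs0 : ∀ n, s n < 0 := fun n => by
    simp only [hs, Left.neg_neg_iff]
    positivity
  have hval : ∀ n, φ (s n) / s n = ((∫ t in Set.Ioi (0 : ℝ), 1 / (t - s n) ∂μ : ℝ) : ℂ) :=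
    fun n => by
      have hne : (s n : ℂ) ≠ 0 := by exact_mod_cast (hs0 n).ne
      rw [h.eq_integral _ (ofReal_mem_cutPlane (hs0 n)), ← integral_complex_ofReal,
        ← integral_div]
      refine integral_congr_ae (Eventually.of_forall fun v => ?_)
      simp only
      push_cast
      rw [div_right_comm, div_self hne]
  have hpos : ∀ n, ∀ t ∈ Set.Ioi (0 : ℝ), 0 < t - s n := fun n t ht => by
    have : (0 : ℝ) < t := ht
    linarith [hs0 n]
  refine integrable_and_integral_eq_of_tendsto (f := fun n t => 1 / (t - s n)) (fun n => ?_)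
    (fun n => ?_) (fun n => ?_) ?_ ?_
  -- Since `s n = -1 / (n + 2)`, one has `(n + 2) (t - s n) = (n + 2) t + 1 ≥ 1 + t`.
  · refine Integrable.mono' ((h.integrable.const_mul ((n : ℝ) + 2)).integrableOn)
      (by fun_prop : Measurable _).aestronglyMeasurable ?_
    filter_upwards [ae_restrict_mem measurableSet_Ioi] with t ht
    have h1 := hpos n t ht
    have ht' : (0 : ℝ) < t := ht
    have hn : (0 : ℝ) ≤ n := Nat.cast_nonneg n
    rw [Real.norm_of_nonneg (by positivity), mul_one_div, div_le_div_iff₀ h1 (by positivity)]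
    have h2 : ((n : ℝ) + 2) * (t - s n) = ((n : ℝ) + 2) * t + 1 := by
      simp only [hs]
      field_simp
      ring
    rw [h2]
    nlinarith
  · filter_upwards [ae_restrict_mem measurableSet_Ioi] with t ht
    exact (one_div_pos.2 (hpos n t ht)).le
  · filter_upwards [ae_restrict_mem measurableSet_Ioi] with t ht
    exact one_div_le_one_div_of_le ht (by linarith [hs0 n])
  · filter_upwards [ae_restrict_mem measurableSet_Ioi] with t ht
    have ht' : t - 0 ≠ 0 := by simpa using (ne_of_gt ht)
    simpa [Pi.div_def] using (tendsto_const_nhds (x := (1 : ℝ))).div (hst0.const_sub t) ht'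
  · have h1 := (hd.comp hst).congr fun n => hval n
    have h2 := (Complex.continuous_re.tendsto _).comp h1
    simpa [Function.comp_def] using h2
-- Natural domains of commutators and domains of closures
/-- On its natural domain, the commutator is given by the bounded operator. -/
theorem HasCommutator.commutator_apply_eq {T : X →ₗ.[ℂ] X} {U L : X →L[ℂ] X}
    (h : HasCommutator T U L) (x : (commutator T U).domain) : commutator T U x = L x := by
  obtain ⟨hd, he⟩ := h ⟨x, x.2.2⟩
  rw [commutator_apply, he, add_sub_cancel_left]

/-- If `T` and `U` have a bounded commutator on `D(T)` and `U D(T) = D(T)`, then `U` maps the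
domain of the closure onto itself. -/
theorem HasCommutator.image_closure_domain {T : X →ₗ.[ℂ] X} (hT : T.IsClosable) {U : X ≃L[ℂ] X}
    {L : X →L[ℂ] X} (h : HasCommutator T (U : X →L[ℂ] X) L)
    (hU : ∀ x ∈ T.domain, U.symm x ∈ T.domain) :
    U '' (T.closure.domain : Set X) = T.closure.domain := by
  have h1 := h.closure hT
  have h2 := (h.symm hU).closure hT
  refine Set.Subset.antisymm ?_ fun x hx => ⟨U.symm x, (h2 ⟨x, hx⟩).1, U.apply_symm_apply x⟩
  rintro _ ⟨x, hx, rfl⟩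
  exact (h1 ⟨x, hx⟩).1

end HirschCalculus

end

/-! ### The main theorem -/

open HirschCalculus in
theorem corollary3p8 {X : Type*} [NormedAddCommGroup X] [NormedSpace ℂ X] [CompleteSpace X]
    (I : OperatorIdeal X) (U : X ≃L[ℂ] X)
    (φ : ℂ → ℂ) (hφ : NegCompleteBernstein φ)
    -- the constant and the linear term of the integral representation of `φ` vanish
    (hc : Tendsto (fun s : ℝ => φ (s : ℂ)) (𝓝[<] 0) (𝓝 0))
    (hb : Tendsto (fun s : ℝ => φ (s : ℂ) / (s : ℂ)) atBot (𝓝 0))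
    -- `d` is the finite value of `φ'(-0)`
    (d : ℝ) (hd : Tendsto (fun s : ℝ => deriv φ (s : ℂ)) (𝓝[<] 0) (𝓝 (d : ℂ)))
    (A : X →ₗ.[ℂ] X) (hA : IsNonpositive A)
    -- `[A, U] = A U - U A` belongs to the ideal, the domains of the two products being comparable
    (hdom : U '' (A.domain : Set X) ⊆ A.domain ∨ (A.domain : Set X) ⊆ U '' A.domain)
    (K : I.carrier)
    (hK : ∀ x : (commutator A (U : X →L[ℂ] X)).domain,
      commutator A (U : X →L[ℂ] X) x = (K : X →L[ℂ] X) x) :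
    U '' ((hirschOp φ A).domain : Set X) = (hirschOp φ A).domain ∧
      ∃ L : I.carrier,
        (∀ x : (commutator (hirschOp φ A) (U : X →L[ℂ] X)).domain,
          commutator (hirschOp φ A) (U : X →L[ℂ] X) x = (L : X →L[ℂ] X) x) ∧
        I.nrm L ≤ nonposBound A ^ 2 * d * I.nrm K := by
  have hμ := isRepresentingMeasure_representingMeasure (hφ.exists_isRepresentingMeasure hc hb)
  obtain ⟨hint, hval⟩ := hμ.integral_one_div
    (tendsto_div_of_tendsto_deriv hφ.differentiableOn hc hd)
  obtain ⟨hAU, hsymm⟩ := hasCommutator_of_commutator hA hdom hK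
  obtain ⟨L, hL, hnorm⟩ :=
    exists_hasCommutator_hirschIntegral hA I (U := (U : X →L[ℂ] X)) K hAU hμ.integrable hint
  have hcl := isClosable_hirschIntegral hA hint
  rw [hval] at hnorm
  refine ⟨hL.image_closure_domain hcl ?_, L, (hL.closure hcl).commutator_apply_eq, hnorm⟩
  rw [hirschIntegral_domain hA hμ.integrable]
  exact hsymm
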